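/- Let $n\ge 2$, $1\le d\le n$, $\varepsilon\in(0,1)$, and let $\mathbb G_{d,n}$ be the Grassmannian of $d$-planes of $\mathbb R^n$, a plane $S$ being identified with the orthogonal projection onto it. A $d$-varifold is a nonnegative Radon measure $V$ on $\mathbb R^n\times\mathbb G_{d,n}$; its mass measure is $\|V\|(A)=V(A\times\mathbb G_{d,n})$, and, for a $C^1$ diffeomorphism $f$ of $\mathbb R^n$, its push-forward $f_\#V$ is given by $(f_\#V)(\phi)=\int\phi(f(x),Df(x)(S))\,J_Sf(x)\,dV(x,S)$, with $J_Sf(x)$ the tangential Jacobian of $f$ along $S$. Kernel and approximate mean curvature. Let $\psi\in C^\infty(\mathbb R^n,[0,1])$ be radially symmetric with $\psi(x)=1$ for $|x|\le\frac12$ and $\psi(x)=0$ for $|x|\ge1$. Put $\hat\Phi_\varepsilon(x)=(2\pi\varepsilon^2)^{-n/2}e^{-|x|^2/(2\varepsilon^2)}$ and $\Phi_\varepsilon=\psi\hat\Phi_\varepsilon/\int\psi\hat\Phi_\varepsilon$. For a varifold $V$ of finite mass let $$(\Phi_\varepsilon*\|V\|)(x)=\int\Phi_\varepsilon(y-x)\,d\|V\|(y),\qquad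 (\Phi_\varepsilon*\delta V)(x)=\int S(\nabla\Phi_\varepsilon(y-x))\,dV(y,S),$$ $$\tilde h_\varepsilon(y,V)=-\frac{(\Phi_\varepsilon*\delta V)(y)}{(\Phi_\varepsilon*\|V\|)(y)+\varepsilon},\qquad h_\varepsilon(\cdot,V)=\Phi_\varepsilon*\tilde h_\varepsilon(\cdot,V).$$ Approximate mean curvature flow. Let $V_0$ be a $d$-varifold of finite mass and compact support. For a subdivision $\mathcal T=\{0=t_0<\dots<t_m=1\}$ with $\delta(\mathcal T)=\max_i(t_i-t_{i-1})$ small enough, the time-discrete flow is defined by $V_{\varepsilon,\mathcal T}(0)=V_0$ and $$V_{\varepsilon,\mathcal T}(t)=\big[\mathrm{id}+(t-t_i)\,h_\varepsilon(\cdot,V_{\varepsilon,\mathcal T}(t_i))\big]_\#V_{\varepsilon,\mathcal T}(t_i)\qquad\text{for } t\in[t_i,t_{i+1}].$$ A family of $d$-varifolds $(V_\varepsilon(t))_{t\in[0,1]}$ is an approximate mean curvature flow starting from $V_0$ if, for some sequence of subdivisions $\mathcal T_j$ of $[0,1]$ with $\delta(\mathcal T_j)\to0$, the varifolds $V_{\varepsilon,\mathcal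 T_j}(t)$ converge weakly-$*$ to $V_\varepsilon(t)$ for every $t\in[0,1]$. Statement (mass decay). Let $(V_\varepsilon(t))_{t\in[0,1]}$ be an approximate mean curvature flow starting from $V_0$. Then all the masses $\|V_\varepsilon(t)\|(\mathbb R^n)$ are finite, the space and time integrals below converge, and for all $0\le a<b\le1$ $$\|V_\varepsilon(b)\|(\mathbb R^n)-\|V_\varepsilon(a)\|(\mathbb R^n)=-\int_a^b\int_{\mathbb R^n}\frac{|(\Phi_\varepsilon*\delta V_\varepsilon(t))(y)|^2}{(\Phi_\varepsilon*\|V_\varepsilon(t)\|)(y)+\varepsilon}\,dy\,dt\le0 .$$ In particular, $\|V_\varepsilon(t)\|(\mathbb R^n)\le\|V_0\|(\mathbb R^n)$ for all $t\in[0,1]$, and $$\int_0^1\int_{\mathbb R^n}\frac{|(\Phi_\varepsilon*\delta V_\varepsilon(t))(y)|^2}{(\Phi_\varepsilon*\|V_\varepsilon(t)\|)(y)+\varepsilon}\,dy\,dt\le\|V_0\|(\mathbb R^n).$$ -/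

import Mathlib

open MeasureTheory Set Filter Topology

namespace ApproxMCF

/-- The Euclidean space `ℝⁿ`. -/
abbrev E (n : ℕ) := EuclideanSpace ℝ (Fin n)

/-- The Grassmannian of `d`-dimensional subspaces of `ℝⁿ`: a subspace is identified with the
orthogonal projection onto it, and the distance is the operator norm of the difference. -/
abbrev Grass (n d : ℕ) :=
  {P : E n →L[ℝ] E n // IsStarProjection P ∧ Module.finrank ℝ P.range = d}

/-- The `d`-varifolds in `ℝⁿ` are the locally finite measures of this type (on this space, these
are exactly the nonnegative Radon measures). -/
abbrev VMeasure (n d : ℕ) := Measure (E n × Grass n d)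

variable {n d : ℕ}

/-- The mass measure `‖V‖(A) = V(A × 𝔾)`. -/
noncomputable def mass (V : VMeasure n d) : Measure (E n) := V.map Prod.fst

/-! ### Push-forward of a varifold -/

/-- The image `L(S)` of the `d`-plane `S` under a linear map `L` (which is a `d`-plane if `L` is
injective on `S`; otherwise the value is irrelevant, and taken to be `S`). -/
noncomputable def imagePlane (L : E n →L[ℝ] E n) (S : Grass n d) : Grass n d :=
  open Classical in
  if h : Module.finrank ℝ (S.1.range.map (L : E n →ₗ[ℝ] E n)) = d then
    ⟨(S.1.range.map (L : E n →ₗ[ℝ] E n)).starProjection,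
      isStarProjection_starProjection, by rwa [Submodule.range_starProjection]⟩
  else S

/-- The tangential Jacobian `det(YᵗY)^{1/2}` with `Y = (L s₁ | … | L s_d)`, for an orthonormal basis
`s₁, …, s_d` of `S`. -/
noncomputable def tangentialJacobian (L : E n →L[ℝ] E n) (S : Grass n d) : ℝ :=
  let s := stdOrthonormalBasis ℝ S.1.range
  Real.sqrt (Matrix.det (Matrix.of fun i j => inner ℝ (L (s i)) (L (s j))))

/-- The push-forward `f_# V`:
`(f_# V)(φ) = ∫ φ(f(x), Df(x)(S)) J_S f(x) dV(x,S)`. -/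
noncomputable def pushforward (f : E n → E n) (V : VMeasure n d) : VMeasure n d :=
  (V.withDensity fun p => ENNReal.ofReal (tangentialJacobian (fderiv ℝ f p.1) p.2)).map
    fun p => (f p.1, imagePlane (fderiv ℝ f p.1) p.2)

/-! ### The regularization kernel -/

/-- Smooth radially symmetric cut-off functions, equal to `1` on the ball of radius `1/2` and to
`0` outside the unit ball. -/
structure IsCutoff (ψ : E n → ℝ) : Prop where
  smooth : ContDiff ℝ (⊤ : ℕ∞) ψ
  radial : ∀ x y, ‖x‖ = ‖y‖ → ψ x = ψ y
  eq_one : ∀ x, ‖x‖ ≤ 1 / 2 → ψ x = 1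
  eq_zero : ∀ x, 1 ≤ ‖x‖ → ψ x = 0
  nonneg : ∀ x, 0 ≤ ψ x
  le_one : ∀ x, ψ x ≤ 1

/-- The Gaussian `(2πε²)^{-n/2} exp(-|x|²/(2ε²))`. -/
noncomputable def gaussianKernel (ε : ℝ) (x : E n) : ℝ :=
  1 / (2 * Real.pi * ε ^ 2) ^ ((n : ℝ) / 2) * Real.exp (-‖x‖ ^ 2 / (2 * ε ^ 2))

/-- The kernel `Φ_ε = c(ε) ψ Φ̂_ε`, with `c(ε) = 1 / ∫ ψ Φ̂_ε`. -/
noncomputable def kernel (ψ : E n → ℝ) (ε : ℝ) (x : E n) : ℝ :=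
  1 / (∫ z, ψ z * gaussianKernel ε z) * (ψ x * gaussianKernel ε x)

/-- `(Φ_ε ∗ ‖V‖)(x) = ∫ Φ_ε(y - x) d‖V‖(y)`. -/
noncomputable def convMass (ψ : E n → ℝ) (ε : ℝ) (V : VMeasure n d) (x : E n) : ℝ :=
  ∫ y, kernel ψ ε (y - x) ∂(mass V)

/-- `(Φ_ε ∗ δV)(x) = ∫ S(∇Φ_ε(y - x)) dV(y,S)`; its component along `e` is the first variation
`δV(X) = ∫ tr(S DX) dV` of `V` at the vector field `X(y) = Φ_ε(y - x) e`. -/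
noncomputable def convFirstVar (ψ : E n → ℝ) (ε : ℝ) (V : VMeasure n d) (x : E n) : E n :=
  ∫ p, p.2.1 (gradient (kernel ψ ε) (p.1 - x)) ∂V

/-! ### The approximate mean curvature and the time-discrete flows -/

/-- `h̃_ε(y, V) = - (Φ_ε ∗ δV)(y) / ((Φ_ε ∗ ‖V‖)(y) + ε)`. -/
noncomputable def hTilde (ψ : E n → ℝ) (ε : ℝ) (V : VMeasure n d) (y : E n) : E n :=
  -((convMass ψ ε V y + ε)⁻¹ • convFirstVar ψ ε V y)

/-- The approximate mean curvature `h_ε(·, V) = Φ_ε ∗ h̃_ε(·, V)`. -/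
noncomputable def approxCurvature (ψ : E n → ℝ) (ε : ℝ) (V : VMeasure n d) (x : E n) : E n :=
  ∫ y, kernel ψ ε (x - y) • hTilde ψ ε V y

/-- One step of length `τ`: the push-forward of `V` by `id + τ h_ε(·, V)`. -/
noncomputable def step (ψ : E n → ℝ) (ε τ : ℝ) (V : VMeasure n d) : VMeasure n d :=
  pushforward (fun x => x + τ • approxCurvature ψ ε V x) V

/-- A subdivision `0 = t₀ < t₁ < … < t_m = 1` of `[0,1]` (only the values `t i`, `i ≤ m`, matter). -/
structure Subdivision where
  m : ℕ
  t : ℕ → ℝ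
  start : t 0 = 0
  finish : t m = 1
  lt_succ : ∀ i < m, t i < t (i + 1)

/-- The size `δ(𝒯) = max_i (t_i - t_{i-1})`. -/
noncomputable def Subdivision.size (T : Subdivision) : ℝ :=
  ⨆ i : Fin T.m, (T.t (i + 1) - T.t i)

/-- The values `V_{ε,𝒯}(t_i)` at the points of the subdivision. -/
noncomputable def nodeFlow (ψ : E n → ℝ) (ε : ℝ) (T : Subdivision) (V₀ : VMeasure n d) :
    ℕ → VMeasure n d
  | 0 => V₀
  | i + 1 => step ψ ε (T.t (i + 1) - T.t i) (nodeFlow ψ ε T V₀ i)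

/-- The index `i < m` with `s ∈ [t_i, t_{i+1}]` (the largest one), for `s ∈ [0,1]`. -/
noncomputable def Subdivision.index (T : Subdivision) (s : ℝ) : ℕ :=
  open Classical in Nat.findGreatest (fun i => T.t i ≤ s) (T.m - 1)

/-- The time-discrete approximate mean curvature flow `V_{ε,𝒯}(s)`, `s ∈ [0,1]`:
`V_{ε,𝒯}(s) = [id + (s - t_i) h_ε(·, V_{ε,𝒯}(t_i))]_# V_{ε,𝒯}(t_i)` for `s ∈ [t_i, t_{i+1}]`. -/
noncomputable def discreteFlow (ψ : E n → ℝ) (ε : ℝ) (T : Subdivision) (V₀ : VMeasure n d)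
    (s : ℝ) : VMeasure n d :=
  step ψ ε (s - T.t (T.index s)) (nodeFlow ψ ε T V₀ (T.index s))

/-- Weak-∗ convergence of Radon measures. -/
def WeakStarTendsto {X : Type*} [TopologicalSpace X] [MeasurableSpace X]
    (μ : ℕ → Measure X) (ν : Measure X) : Prop :=
  ∀ φ : X → ℝ, Continuous φ → HasCompactSupport φ → (∀ x, 0 ≤ φ x) →
    Tendsto (fun j => ∫ x, φ x ∂(μ j)) atTop (𝓝 (∫ x, φ x ∂ν))

/-- `(V(t))_{t ∈ [0,1]}` is the approximate mean curvature flow at scale `ε` starting from `V₀`: a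
family of varifolds that is the limit of the time-discrete flows starting from `V₀` along
subdivisions whose size tends to `0`. -/
def IsApproxFlow (ψ : E n → ℝ) (ε : ℝ) (V₀ : VMeasure n d) (V : ℝ → VMeasure n d) : Prop :=
  (∀ t ∈ Icc (0 : ℝ) 1, IsLocallyFiniteMeasure (V t)) ∧
  ∃ T : ℕ → Subdivision, Tendsto (fun j => (T j).size) atTop (𝓝 0) ∧
    ∀ t ∈ Icc (0 : ℝ) 1, WeakStarTendsto (fun j => discreteFlow ψ ε (T j) V₀ t) (V t)

/-- The integrand `|(Φ_ε ∗ δV)(y)|² / ((Φ_ε ∗ ‖V‖)(y) + ε)`. -/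
noncomputable def dissipationDensity (ψ : E n → ℝ) (ε : ℝ) (V : VMeasure n d) (y : E n) : ℝ :=
  ‖convFirstVar ψ ε V y‖ ^ 2 / (convMass ψ ε V y + ε)

end ApproxMCF

open ApproxMCF

/-! One step by `id + τ h` changes the mass by `τ δV(h) + o(τ)`, because the tangential Jacobian of
`1 + B` along `S` is `1 + tr(S B) + o(‖B‖)`, uniformly in `S` (`tangentialJacobian_expansion`). As
`h` is itself the convolution of the kernel with `hTilde`, Fubini moves this second convolution onto
`δV`, and `δV(h)` becomes minus the dissipation (`integral_trace_fderiv_approxCurvature`). The error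
`o(τ)` depends on `V` only through a mass bound: the `ε` in the denominator bounds `hTilde`, hence
`h` and `Dh` (`exists_curvature_bound`).

For fine subdivisions the masses therefore stay below the initial mass plus one, the supports stay
in a fixed ball (`exists_nodeFlow_confined`), and the one-step errors add up to a small multiple of
the elapsed time (`exists_nodeFlow_mass_balance`).

In the limit, the discrete flow may be replaced by its piecewise constant version, which has the
same weak limits (`weakStarTendsto_constFlow`). A fixed ball times the compact Grassmannian is
compact, so no mass escapes and integrals of all continuous functions converge. Dominated
convergence in space and then in time passes the dissipation to the limit (`limit_mass_balance`),
and differences of the balance at two times give the theorem. -/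

namespace ApproxMCF
variable {n d : ℕ}

/-! ### Trace, determinant and the first order expansion of the tangential Jacobian. -/

/-- The trace of a continuous endomorphism, as a continuous linear form. -/
noncomputable def traceCLM (n : ℕ) : (E n →L[ℝ] E n) →L[ℝ] ℝ :=
  LinearMap.toContinuousLinearMap
    ((LinearMap.trace ℝ (E n)) ∘ₗ (ContinuousLinearMap.coeLM ℝ))

lemma traceCLM_apply (A : E n →L[ℝ] E n) :
    traceCLM n A = LinearMap.trace ℝ (E n) (A : E n →ₗ[ℝ] E n) := rfl

lemma traceCLM_mul_comm (A B : E n →L[ℝ] E n) : traceCLM n (A * B) = traceCLM n (B * A) := by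
  simp only [traceCLM_apply]
  exact LinearMap.trace_mul_comm ℝ (A : E n →ₗ[ℝ] E n) (B : E n →ₗ[ℝ] E n)

lemma traceCLM_star (A : E n →L[ℝ] E n) : traceCLM n (star A) = traceCLM n A := by
  set b := EuclideanSpace.basisFun (Fin n) ℝ
  rw [traceCLM_apply, traceCLM_apply, LinearMap.trace_eq_matrix_trace ℝ b.toBasis,
    LinearMap.trace_eq_matrix_trace ℝ b.toBasis, ContinuousLinearMap.star_eq_adjoint,
    ← ContinuousLinearMap.adjoint_toLinearMap, LinearMap.toMatrix_adjoint,
    Matrix.trace_conjTranspose, star_trivial]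

lemma traceCLM_smulRight (ℓ : E n →L[ℝ] ℝ) (w : E n) : traceCLM n (ℓ.smulRight w) = ℓ w := by
  rw [traceCLM_apply]
  exact LinearMap.trace_smulRight (ℓ : E n →ₗ[ℝ] ℝ) w

lemma contDiff_det : ContDiff ℝ 1 (fun A : E n →L[ℝ] E n => A.det) := by
  set b := EuclideanSpace.basisFun (Fin n) ℝ
  have h : (fun A : E n →L[ℝ] E n => A.det) = fun A => ∑ σ : Equiv.Perm (Fin n),
      (Equiv.Perm.sign σ : ℤ) • ∏ i, inner ℝ (b (σ i)) (A (b i)) := by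
    funext A
    rw [ContinuousLinearMap.det, ← LinearMap.det_toMatrix b.toBasis, Matrix.det_apply]
    refine Finset.sum_congr rfl fun σ _ => ?_
    rw [Units.smul_def]
    congr 1
    refine Finset.prod_congr rfl fun i _ => ?_
    rw [LinearMap.toMatrix_apply]
    simp [OrthonormalBasis.repr_apply_apply]
  rw [h]
  refine ContDiff.sum fun σ _ => ContDiff.const_smul _ (contDiff_prod fun i _ => ?_)
  exact ((innerSL ℝ (b (σ i))) ∘L (ContinuousLinearMap.apply ℝ (E n) (b i))).contDiff

/-- The determinant is polynomial in the entries, so it is differentiable; its derivative is then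
read off along the lines `1 + t X`, where the determinant is `1 + t tr X + O(t²)`. -/
lemma hasFDerivAt_det_one :
    HasFDerivAt (fun A : E n →L[ℝ] E n => A.det) (traceCLM n) 1 := by
  have h1 := (contDiff_det (n := n)).differentiable one_ne_zero 1
  suffices h : traceCLM n = fderiv ℝ (fun A : E n →L[ℝ] E n => A.det) 1 by
    rw [h]; exact h1.hasFDerivAt
  refine ContinuousLinearMap.ext fun X => ?_
  have h2 : HasDerivAt (fun t : ℝ => (1 : E n →L[ℝ] E n) + t • X) X 0 := by
    simpa using ((hasDerivAt_id (0 : ℝ)).smul_const X).const_add (1 : E n →L[ℝ] E n)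
  have h3 : HasDerivAt (fun t : ℝ => ((1 : E n →L[ℝ] E n) + t • X).det)
      (fderiv ℝ (fun A : E n →L[ℝ] E n => A.det) 1 X) 0 := by
    have h := h1.hasFDerivAt
    have h0 : (1 : E n →L[ℝ] E n) = 1 + (0 : ℝ) • X := by rw [zero_smul ℝ X, add_zero]
    rw [h0] at h
    have := HasFDerivAt.comp_hasDerivAt (0 : ℝ) h h2
    rwa [← h0] at this
  refine HasDerivAt.unique ?_ h3
  set b := EuclideanSpace.basisFun (Fin n) ℝ
  set M := LinearMap.toMatrix b.toBasis b.toBasis (X : E n →ₗ[ℝ] E n)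
  have h4 : (fun t : ℝ => ((1 : E n →L[ℝ] E n) + t • X).det) = fun t => (1 + t • M).det := by
    funext t
    rw [ContinuousLinearMap.det, ← LinearMap.det_toMatrix b.toBasis]
    congr 1
    change LinearMap.toMatrix b.toBasis b.toBasis ((1 : E n →ₗ[ℝ] E n) + t • (X : E n →ₗ[ℝ] E n)) = _
    rw [map_add, map_smul, LinearMap.toMatrix_one]
  rw [h4, traceCLM_apply, LinearMap.trace_eq_matrix_trace ℝ b.toBasis]
  change HasDerivAt _ M.trace 0
  have h6 := fun t : ℝ => Matrix.det_one_add_smul t M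
  rw [funext h6]
  set q := (Matrix.det (1 + (Polynomial.X : Polynomial ℝ) • M.map Polynomial.C)).divX.divX
  have h5 : HasDerivAt (fun t : ℝ => 1 + M.trace * t + q.eval t * t ^ 2)
      (M.trace * 1 + (q.derivative.eval 0 * 0 ^ 2 + q.eval 0 * ((2 : ℕ) * 0 ^ (2 - 1) ))) 0 :=
    (((hasDerivAt_id (0 : ℝ)).const_mul M.trace).const_add 1).add
      ((q.hasDerivAt 0).mul (hasDerivAt_pow 2 0))
  simpa using h5

/-- The matrix of an endomorphism in the standard basis. -/
noncomputable def stdMatrix (A : E n →L[ℝ] E n) : Matrix (Fin n) (Fin n) ℝ :=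
  LinearMap.toMatrix (EuclideanSpace.basisFun (Fin n) ℝ).toBasis
    (EuclideanSpace.basisFun (Fin n) ℝ).toBasis (A : E n →ₗ[ℝ] E n)

lemma stdMatrix_apply (A : E n →L[ℝ] E n) (i j : Fin n) :
    stdMatrix A i j = inner ℝ (EuclideanSpace.basisFun (Fin n) ℝ i)
      (A (EuclideanSpace.basisFun (Fin n) ℝ j)) := by
  rw [stdMatrix, LinearMap.toMatrix_apply]
  simp only [OrthonormalBasis.coe_toBasis, OrthonormalBasis.coe_toBasis_repr_apply,
    OrthonormalBasis.repr_apply_apply]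
  rfl

lemma stdMatrix_add (A B : E n →L[ℝ] E n) : stdMatrix (A + B) = stdMatrix A + stdMatrix B :=
  map_add (LinearMap.toMatrix _ _) (A : E n →ₗ[ℝ] E n) (B : E n →ₗ[ℝ] E n)

lemma stdMatrix_one : stdMatrix (1 : E n →L[ℝ] E n) = 1 := LinearMap.toMatrix_one _

lemma stdMatrix_mul (A B : E n →L[ℝ] E n) : stdMatrix (A * B) = stdMatrix A * stdMatrix B :=
  LinearMap.toMatrix_mul _ (A : E n →ₗ[ℝ] E n) (B : E n →ₗ[ℝ] E n)

lemma det_stdMatrix (A : E n →L[ℝ] E n) : (stdMatrix A).det = A.det :=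
  LinearMap.det_toMatrix _ _

section Adjoint

variable {H : Type*} [NormedAddCommGroup H] [InnerProductSpace ℝ H] [CompleteSpace H]

/-- The operator `P (L† L - 1) P`. -/
noncomputable def gramDefect (L P : H →L[ℝ] H) : H →L[ℝ] H := P * (star L * L - 1) * P

/-- Separates the linear part in `B` from the quadratic one. The two linear terms are adjoint, so
they have the same trace; the factor 2 cancels the 1/2 from the square root in the Jacobian. -/
lemma gramDefect_one_add {P : H →L[ℝ] H} (hP : star P = P) (B : H →L[ℝ] H) :
    gramDefect (1 + B) P = P * B * P + star (P * B * P) + P * (star B * B) * P := by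
  rw [gramDefect, star_mul, star_mul, hP, star_add, star_one]
  noncomm_ring

lemma norm_star_mul_self_le (B : H →L[ℝ] H) : ‖star B * B‖ ≤ ‖B‖ * ‖B‖ := by
  exact (norm_mul_le (star B) B).trans_eq (congrArg (· * ‖B‖) (norm_star B))

lemma norm_star_eq (B : H →L[ℝ] H) : ‖star B‖ = ‖B‖ := norm_star B

lemma continuous_star_clm : Continuous fun L : H →L[ℝ] H => star L := continuous_star

lemma continuous_gramDefect {X : Type*} [TopologicalSpace X] {L P : X → H →L[ℝ] H}
    (hL : Continuous L) (hP : Continuous P) : Continuous fun q => gramDefect (L q) (P q) := by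
  unfold gramDefect
  fun_prop

lemma star_sub_mul_eq {P Q : H →L[ℝ] H} (hP : star P = P) (hQ : star Q = Q) :
    star (P - Q * P) = P - P * Q := by
  rw [star_sub, star_mul, hP, hQ]

end Adjoint

lemma Grass.mul_self (S : Grass n d) : S.1 * S.1 = S.1 := S.2.1.isIdempotentElem

lemma Grass.star_eq (S : Grass n d) : star S.1 = S.1 := S.2.1.isSelfAdjoint

lemma Grass.apply_apply (S : Grass n d) (x : E n) : S.1 (S.1 x) = S.1 x :=
  DFunLike.congr_fun S.mul_self x

lemma Grass.inner_left (S : Grass n d) (x y : E n) : inner ℝ (S.1 x) y = inner ℝ x (S.1 y) := by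
  have := ContinuousLinearMap.adjoint_inner_left S.1 y x
  rwa [← ContinuousLinearMap.star_eq_adjoint, S.star_eq] at this

lemma Grass.apply_of_mem (S : Grass n d) {x : E n} (hx : x ∈ S.1.range) : S.1 x = x := by
  obtain ⟨y, rfl⟩ := hx
  exact S.apply_apply y

lemma Grass.norm_le (S : Grass n d) : ‖S.1‖ ≤ 1 := S.2.1.norm_le

lemma Grass.norm_apply_le (S : Grass n d) (x : E n) : ‖S.1 x‖ ≤ ‖x‖ := by
  simpa using S.1.le_of_opNorm_le S.norm_le x

-- Removes the choice of a basis of `S`, which cannot be made continuously. If the columns of `U`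
-- form the basis, then `U Uᵀ` is the projection, `Uᵀ U = 1`, and the Gram matrix is `1 + Uᵀ N U`;
-- the identity `det (1 + A B) = det (1 + B A)` turns its determinant into that of an operator on
-- the whole space.
set_option maxHeartbeats 1000000 in
lemma tangentialJacobian_eq (L : E n →L[ℝ] E n) (S : Grass n d) :
    tangentialJacobian L S = Real.sqrt (1 + gramDefect L S.1).det := by
  unfold tangentialJacobian
  simp only
  congr 1
  set s := stdOrthonormalBasis ℝ S.1.range
  set b := EuclideanSpace.basisFun (Fin n) ℝ
  set U : Matrix (Fin n) (Fin (Module.finrank ℝ S.1.range)) ℝ :=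
    Matrix.of fun i j => inner ℝ (b i) (s j : E n)
  set N := stdMatrix (star L * L - 1)
  have hN : ∀ i j, N i j = inner ℝ (b i) ((star L * L - 1 : E n →L[ℝ] E n) (b j)) :=
    stdMatrix_apply _
  have hP : stdMatrix S.1 = U * U.transpose := by
    ext i j
    rw [stdMatrix_apply, Matrix.mul_apply]
    simp only [U, Matrix.of_apply, Matrix.transpose_apply]
    have h1 : S.1 (b j) = ∑ k, inner ℝ (s k : E n) (b j) • (s k : E n) := by
      have h2 := s.sum_repr' ⟨S.1 (b j), ⟨b j, rfl⟩⟩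
      have h3 := congrArg (fun z : S.1.range => (z : E n)) h2
      simp only [Submodule.coe_sum, Submodule.coe_smul, Submodule.coe_inner] at h3
      rw [← h3]
      refine Finset.sum_congr rfl fun k _ => ?_
      congr 1
      rw [← S.inner_left, S.apply_of_mem (s k).2]
    change inner ℝ (b i) (S.1 (b j)) = _
    rw [h1, inner_sum]
    refine Finset.sum_congr rfl fun k _ => ?_
    rw [inner_smul_right, mul_comm, real_inner_comm (b j)]
  have hexp : ∀ x : E n, ∑ i, inner ℝ (b i) x • b i = x := fun x => b.sum_repr' x
  have hUU : U.transpose * U = 1 := by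
    ext i j
    rw [Matrix.mul_apply, Matrix.one_apply]
    simp only [U, Matrix.of_apply, Matrix.transpose_apply]
    have h1 : ∀ k, inner ℝ (b k) (s i : E n) * inner ℝ (b k) (s j : E n)
        = inner ℝ (s i : E n) (b k) * inner ℝ (b k) (s j : E n) := fun k => by
      rw [real_inner_comm (b k) (s i : E n)]
    rw [Finset.sum_congr rfl fun k _ => h1 k, b.sum_inner_mul_inner,
      ← Submodule.coe_inner, s.inner_eq_ite]
  have hG : (Matrix.of fun i j => inner ℝ (L (s i)) (L (s j)))
      = 1 + U.transpose * N * U := by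
    ext i j
    have h1 : (U.transpose * N * U) i j
        = inner ℝ (s i : E n) ((star L * L - 1 : E n →L[ℝ] E n) (s j : E n)) := by
      rw [Matrix.mul_assoc, Matrix.mul_apply]
      conv_rhs => rw [← b.sum_inner_mul_inner]
      refine Finset.sum_congr rfl fun k _ => ?_
      rw [Matrix.transpose_apply, real_inner_comm]
      congr 1
      rw [Matrix.mul_apply]
      conv_rhs => rw [← hexp (s j : E n)]
      rw [map_sum, inner_sum]
      refine Finset.sum_congr rfl fun l _ => ?_
      rw [hN, map_smul, inner_smul_right, mul_comm]
      rfl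
    rw [Matrix.add_apply, h1, Matrix.of_apply, Matrix.one_apply, sub_apply,
      inner_sub_right, mul_apply_eq_comp, one_apply_eq_self,
      ContinuousLinearMap.star_eq_adjoint, ContinuousLinearMap.adjoint_inner_right,
      ← Submodule.coe_inner, s.inner_eq_ite]
    ring
  have h6 : stdMatrix (1 + gramDefect L S.1) = 1 + U * (U.transpose * N * U * U.transpose) := by
    rw [stdMatrix_add, stdMatrix_one, gramDefect, stdMatrix_mul, stdMatrix_mul, hP]
    simp only [Matrix.mul_assoc]
    rfl
  rw [hG, ← det_stdMatrix]
  rw [h6, Matrix.det_one_add_mul_comm U (U.transpose * N * U * U.transpose)]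
  rw [Matrix.mul_assoc _ U.transpose U, hUU, Matrix.mul_one]

lemma norm_conj_le (S : Grass n d) (A : E n →L[ℝ] E n) : ‖S.1 * A * S.1‖ ≤ ‖A‖ := by
  have h := S.norm_le
  calc ‖S.1 * A * S.1‖ ≤ ‖S.1‖ * ‖A‖ * ‖S.1‖ :=
        (norm_mul_le _ _).trans (mul_le_mul_of_nonneg_right (norm_mul_le _ _) (norm_nonneg _))
    _ ≤ 1 * ‖A‖ * 1 := by gcongr
    _ = ‖A‖ := by ring

lemma traceCLM_conj (S : Grass n d) (A : E n →L[ℝ] E n) :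
    traceCLM n (S.1 * A * S.1) = traceCLM n (S.1 * A) := by
  rw [traceCLM_mul_comm, ← mul_assoc, S.mul_self]

lemma Grass.norm_sub_apply_le (S : Grass n d) (x : E n) : ‖x - S.1 x‖ ≤ ‖x‖ := by
  have h1 := norm_sub_sq_real x (S.1 x)
  have h2 : inner ℝ x (S.1 x) = ‖S.1 x‖ ^ 2 := by
    rw [← real_inner_self_eq_norm_sq, S.inner_left, S.apply_apply]
  rw [h2] at h1
  exact abs_le_of_sq_le_sq' (by nlinarith [sq_nonneg ‖S.1 x‖]) (norm_nonneg _) |>.2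

lemma tangentialJacobian_nonneg (L : E n →L[ℝ] E n) (S : Grass n d) :
    0 ≤ tangentialJacobian L S := by
  rw [tangentialJacobian_eq]; exact Real.sqrt_nonneg _

/-- The first order expansion of the tangential Jacobian near the identity, uniform in the plane. -/
lemma tangentialJacobian_expansion {η : ℝ} (hη : 0 < η) :
    ∃ δ > 0, ∀ (B : E n →L[ℝ] E n) (S : Grass n d), ‖B‖ ≤ δ →
      |tangentialJacobian (1 + B) S - 1 - traceCLM n (S.1 * B)| ≤ η * ‖B‖ := by
  have hG : HasFDerivAt (fun A : E n →L[ℝ] E n => Real.sqrt A.det)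
      ((1 / 2 : ℝ) • traceCLM n) 1 := by
    have h0 : (1 : E n →L[ℝ] E n).det = 1 := LinearMap.det_id
    have h1 := (hasFDerivAt_det_one (n := n)).sqrt (by rw [h0]; exact one_ne_zero)
    rw [h0] at h1
    simpa using h1
  have h0 : Real.sqrt (1 : E n →L[ℝ] E n).det = 1 := by
    have : (1 : E n →L[ℝ] E n).det = 1 := LinearMap.det_id
    rw [this, Real.sqrt_one]
  rw [hasFDerivAt_iff_isLittleO] at hG
  -- With `‖X‖ ≤ 3‖B‖` this error is at most `η/2 ‖B‖`; the quadratic trace term, halved, takes the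
  -- other `η/2 ‖B‖`.
  have h2 := hG.def (c := η / 6) (by positivity)
  obtain ⟨ρ, hρ, hb⟩ := Metric.eventually_nhds_iff.mp h2
  set K := ‖traceCLM n‖
  have hK : 0 ≤ K := norm_nonneg (traceCLM n)
  -- The first bound gives `‖X‖ ≤ 3‖B‖`, the second then puts `1 + X` within `ρ` of `1`, and the
  -- third makes `K‖B‖² ≤ η‖B‖`.
  refine ⟨min 1 (min (ρ / 4) (η / (K + 1))), by positivity, fun B S hB => ?_⟩
  have hB1 : ‖B‖ ≤ 1 := hB.trans (min_le_left _ _)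
  have hB2 : ‖B‖ ≤ ρ / 4 := hB.trans ((min_le_right _ _).trans (min_le_left _ _))
  have hB3 : ‖B‖ ≤ η / (K + 1) := hB.trans ((min_le_right _ _).trans (min_le_right _ _))
  rw [le_div_iff₀ (by positivity)] at hB3
  have hB0 := norm_nonneg B
  set X := gramDefect (1 + B) S.1 with hX
  have hBB : ‖S.1 * (star B * B) * S.1‖ ≤ ‖B‖ * ‖B‖ :=
    (norm_conj_le S _).trans (norm_star_mul_self_le B)
  have hXn : ‖X‖ ≤ 3 * ‖B‖ := by
    rw [hX, gramDefect_one_add S.star_eq]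
    have h3 := norm_conj_le S B
    have h4 := norm_add₃_le (a := S.1 * B * S.1) (b := star (S.1 * B * S.1))
      (c := S.1 * (star B * B) * S.1)
    rw [norm_star_eq] at h4
    nlinarith
  have hXt : traceCLM n X = 2 * traceCLM n (S.1 * B) + traceCLM n (S.1 * (star B * B) * S.1) := by
    rw [hX, gramDefect_one_add S.star_eq, map_add, map_add, traceCLM_star, traceCLM_conj]; ring
  have h5 := hb (y := 1 + X) (by rw [dist_eq_norm, add_sub_cancel_left]; linarith)
  rw [h0, add_sub_cancel_left, Real.norm_eq_abs, ← tangentialJacobian_eq] at h5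
  have h6 : |traceCLM n (S.1 * (star B * B) * S.1)| ≤ K * (‖B‖ * ‖B‖) :=
    ((traceCLM n).le_opNorm _).trans (by gcongr)
  have h7 : ((1 / 2 : ℝ) • traceCLM n) X = 1 / 2 * traceCLM n X := rfl
  rw [h7, hXt] at h5
  have h8 : K * (‖B‖ * ‖B‖) ≤ η * ‖B‖ := by nlinarith
  rw [abs_le] at h5 h6 ⊢
  have h9 : η / 6 * ‖X‖ ≤ η / 2 * ‖B‖ := by nlinarith
  constructor <;> linarith [h5.1, h5.2, h6.1, h6.2]

lemma continuous_tangentialJacobian {X : Type*} [TopologicalSpace X] {L : X → E n →L[ℝ] E n}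
    {S : X → Grass n d} (hL : Continuous L) (hS : Continuous S) :
    Continuous fun q => tangentialJacobian (L q) (S q) := by
  simp_rw [tangentialJacobian_eq]
  have hS' : Continuous fun q => (S q).1 := continuous_subtype_val.comp hS
  refine Real.continuous_sqrt.comp (ContinuousLinearMap.continuous_det.comp ?_)
  exact continuous_const.add (continuous_gramDefect hL hS')

/-! ### Images of planes -/

lemma imagePlane_val {L : E n →L[ℝ] E n} (hL : Function.Injective L) (S : Grass n d) :
    (imagePlane L S).1 = (S.1.range.map (L : E n →ₗ[ℝ] E n)).starProjection := by
  have h : Module.finrank ℝ (S.1.range.map (L : E n →ₗ[ℝ] E n)) = d := by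
    exact (Submodule.equivMapOfInjective (L : E n →ₗ[ℝ] E n) hL S.1.range).finrank_eq.symm.trans
      S.2.2
  unfold imagePlane
  rw [dif_pos h]

/-- The operator is `L†L` compressed to `S`, plus the identity on the orthogonal complement. For
injective `L` its quadratic form is definite, hence the invertibility below. -/
lemma one_add_gramDefect_inner (L : E n →L[ℝ] E n) (S : Grass n d) (x : E n) :
    inner ℝ ((1 + gramDefect L S.1) x) x = ‖L (S.1 x)‖ ^ 2 + ‖x - S.1 x‖ ^ 2 := by
  have h1 : (1 + gramDefect L S.1) x = x + S.1 (star L (L (S.1 x)) - S.1 x) := rfl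
  rw [h1, inner_add_left, S.inner_left, inner_sub_left, ContinuousLinearMap.star_eq_adjoint,
    ContinuousLinearMap.adjoint_inner_left, real_inner_self_eq_norm_sq, norm_sub_sq_real,
    real_inner_self_eq_norm_sq, real_inner_self_eq_norm_sq]
  have h2 : inner ℝ x (S.1 x) = ‖S.1 x‖ ^ 2 := by
    rw [← real_inner_self_eq_norm_sq, S.inner_left, S.apply_apply]
  rw [h2]; ring

lemma isUnit_one_add_gramDefect {L : E n →L[ℝ] E n} (hL : Function.Injective L) (S : Grass n d) :
    IsUnit (1 + gramDefect L S.1) := by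
  rw [ContinuousLinearMap.isUnit_iff_isUnit_toLinearMap, LinearMap.isUnit_iff_ker_eq_bot,
    LinearMap.ker_eq_bot']
  intro x hx
  have h1 := one_add_gramDefect_inner L S x
  have h2 : (1 + gramDefect L S.1) x = 0 := hx
  rw [h2, inner_zero_left] at h1
  have h3 : ‖L (S.1 x)‖ ^ 2 = 0 := by nlinarith [sq_nonneg ‖L (S.1 x)‖, sq_nonneg ‖x - S.1 x‖]
  have h4 : ‖x - S.1 x‖ ^ 2 = 0 := by nlinarith [sq_nonneg ‖L (S.1 x)‖, sq_nonneg ‖x - S.1 x‖]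
  rw [sq_eq_zero_iff, norm_eq_zero] at h3 h4
  have h5 : S.1 x = 0 := hL (by rw [h3, map_zero])
  rwa [h5, sub_zero] at h4

/-- The explicit formula for the orthogonal projection onto the image of a plane. -/
lemma imagePlane_val_eq {L : E n →L[ℝ] E n} (hL : Function.Injective L) (S : Grass n d) :
    (imagePlane L S).1
      = L * S.1 * Ring.inverse (1 + gramDefect L S.1) * S.1 * star L := by
  rw [imagePlane_val hL]
  refine ContinuousLinearMap.ext fun z => ?_
  refine Submodule.eq_starProjection_of_mem_of_inner_eq_zero ?_ ?_
  · exact ⟨_, ⟨_, rfl⟩, rfl⟩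
  rintro _ ⟨_, ⟨s, rfl⟩, rfl⟩
  set A := 1 + gramDefect L S.1
  have hA : A * Ring.inverse A = 1 := Ring.mul_inverse_cancel _ (isUnit_one_add_gramDefect hL S)
  -- The normal equations: the residual of the candidate projection is orthogonal to `L(S)` exactly
  -- when `S L†` kills it.
  have h1 : S.1 * star L * (L * S.1 * Ring.inverse A * S.1 * star L) = S.1 * star L := by
    have h2 : S.1 * star L * (L * S.1) = S.1 * A := by
      simp only [A, gramDefect, mul_add, mul_one, mul_sub, sub_mul, ← mul_assoc, S.mul_self]
      abel
    calc S.1 * star L * (L * S.1 * Ring.inverse A * S.1 * star L)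
        = (S.1 * star L * (L * S.1)) * Ring.inverse A * S.1 * star L := by simp only [mul_assoc]
      _ = S.1 * (A * Ring.inverse A) * S.1 * star L := by rw [h2]; simp only [mul_assoc]
      _ = S.1 * star L := by rw [hA, mul_one, S.mul_self]
  change inner ℝ (z - (L * S.1 * Ring.inverse A * S.1 * star L) z) (L (S.1 s)) = 0
  rw [← ContinuousLinearMap.adjoint_inner_left, ← ContinuousLinearMap.star_eq_adjoint,
    ← S.inner_left]
  have h3 : S.1 (star L (z - (L * S.1 * Ring.inverse A * S.1 * star L) z)) = 0 := by
    rw [map_sub, map_sub, sub_eq_zero]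
    exact (DFunLike.congr_fun h1 z).symm
  rw [h3, inner_zero_left]

/-- The explicit formula involves only products, adjoints and an inverse taken at units, where
inversion is continuous. -/
lemma continuous_imagePlane {X : Type*} [TopologicalSpace X] {L : X → E n →L[ℝ] E n}
    {S : X → Grass n d} (hL : Continuous L) (hS : Continuous S)
    (hinj : ∀ q, Function.Injective (L q)) :
    Continuous fun q => imagePlane (L q) (S q) := by
  refine Continuous.subtype_mk (f := fun q => (imagePlane (L q) (S q)).1) ?_ _
  simp_rw [fun q => imagePlane_val_eq (hinj q) (S q)]
  have hS' : Continuous fun q => (S q).1 := continuous_subtype_val.comp hS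
  have hA : Continuous fun q => 1 + gramDefect (L q) (S q).1 :=
    continuous_const.add (continuous_gramDefect hL hS')
  have hI : Continuous fun q => Ring.inverse (1 + gramDefect (L q) (S q).1) := by
    rw [continuous_iff_continuousAt]
    intro q
    obtain ⟨u, hu⟩ := isUnit_one_add_gramDefect (hinj q) (S q)
    refine ContinuousAt.comp (g := Ring.inverse) ?_ hA.continuousAt
    rw [← hu]
    exact NormedRing.inverse_continuousAt u
  exact (((hL.mul hS').mul hI).mul hS').mul (continuous_star_clm.comp hL)

lemma injective_one_add {B : E n →L[ℝ] E n} (hB : ‖B‖ ≤ 1 / 2) :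
    Function.Injective (1 + B : E n →L[ℝ] E n) := by
  rw [injective_iff_map_eq_zero]
  intro x hx
  have h1 : x + B x = 0 := hx
  have h2 : ‖x‖ = ‖B x‖ := by
    rw [← norm_neg (B x), ← eq_neg_of_add_eq_zero_left h1]
  have h3 := B.le_of_opNorm_le hB x
  have h4 := norm_nonneg x
  exact norm_eq_zero.mp (by linarith)

/-- A plane is moved by at most `3‖B‖` under the map `1 + B`. -/
lemma dist_imagePlane_le {B : E n →L[ℝ] E n} (hB : ‖B‖ ≤ 1 / 2) (S : Grass n d) :
    dist (imagePlane (1 + B) S) S ≤ 3 * ‖B‖ := by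
  have hinj := injective_one_add hB
  have hB0 := norm_nonneg B
  obtain ⟨T, hT⟩ : ∃ T, T = imagePlane (1 + B) S := ⟨_, rfl⟩
  have hTv := imagePlane_val hinj S
  rw [← hT] at hTv ⊢
  have hBx : ∀ x, ‖B x‖ ≤ ‖B‖ * ‖x‖ := B.le_opNorm
  -- `T` fixes `S x + B (S x)`, so `S x` misses the plane `T` only by the part of `B (S x)`
  -- orthogonal to it.
  have h1 : ‖S.1 - T.1 * S.1‖ ≤ ‖B‖ := by
    refine ContinuousLinearMap.opNorm_le_bound _ hB0 fun x => ?_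
    have e1 : T.1 (S.1 x + B (S.1 x)) = S.1 x + B (S.1 x) := by
      rw [hTv]
      exact Submodule.starProjection_eq_self_iff.mpr ⟨S.1 x, ⟨x, rfl⟩, rfl⟩
    have e2 : (S.1 - T.1 * S.1) x = -(B (S.1 x) - T.1 (B (S.1 x))) := by
      change S.1 x - T.1 (S.1 x) = _
      rw [map_add] at e1
      rw [eq_sub_of_add_eq e1]
      abel
    rw [e2, norm_neg]
    exact (T.norm_sub_apply_le _).trans ((hBx _).trans (by gcongr; exact S.norm_apply_le x))
  -- Conversely `T x = S w + B (S w)` for some `w`; the factor 2 comes from `‖S w‖ ≤ 2‖x‖`, valid as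
  -- `‖B‖ ≤ 1/2`.
  have h2 : ‖T.1 - S.1 * T.1‖ ≤ 2 * ‖B‖ := by
    refine ContinuousLinearMap.opNorm_le_bound _ (by positivity) fun x => ?_
    have hmem : T.1 x ∈ S.1.range.map ((1 + B : E n →L[ℝ] E n) : E n →ₗ[ℝ] E n) := by
      rw [hTv]
      exact Submodule.starProjection_apply_mem _ x
    obtain ⟨_, ⟨w, rfl⟩, hw⟩ := hmem
    have hw' : T.1 x = S.1 w + B (S.1 w) := hw.symm
    have e1 : (T.1 - S.1 * T.1) x = B (S.1 w) - S.1 (B (S.1 w)) := by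
      change T.1 x - S.1 (T.1 x) = _
      rw [hw', map_add, S.apply_apply]
      abel
    have e2 : ‖S.1 w‖ ≤ 2 * ‖x‖ := by
      have e3 : S.1 w = T.1 x - B (S.1 w) := by rw [hw']; abel
      have e4 := norm_sub_le (T.1 x) (B (S.1 w))
      rw [← e3] at e4
      have e5 := B.le_of_opNorm_le hB (S.1 w)
      have e6 := T.norm_apply_le x
      linarith
    rw [e1]
    refine (S.norm_sub_apply_le _).trans ((hBx _).trans ?_)
    nlinarith
  have h3 : ‖T.1 - T.1 * S.1‖ ≤ 2 * ‖B‖ := by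
    have e1 : star (T.1 - S.1 * T.1) = T.1 - T.1 * S.1 := by
      refine (star_sub_mul_eq T.star_eq S.star_eq)
    rw [← e1, norm_star_eq]
    exact h2
  rw [Subtype.dist_eq, dist_eq_norm]
  have e : T.1 - S.1 = (T.1 - T.1 * S.1) - (S.1 - T.1 * S.1) := by abel
  rw [e]
  linarith [norm_sub_le (T.1 - T.1 * S.1) (S.1 - T.1 * S.1)]

/-! ### The Grassmannian is compact -/

/-- The rank of a projection is its trace, so all defining conditions are closed; the norms are at
most 1 and the operator space is finite dimensional. -/
instance : CompactSpace (Grass n d) := by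
  have hset : {P : E n →L[ℝ] E n | IsStarProjection P ∧ Module.finrank ℝ P.range = d}
      = {P | P * P = P} ∩ {P | star P = P} ∩ {P | traceCLM n P = d} := by
    have key : ∀ P : E n →L[ℝ] E n, P * P = P →
        traceCLM n P = (Module.finrank ℝ P.range : ℝ) := fun P hP => by
      have h1 : LinearMap.IsProj P.range (P : E n →ₗ[ℝ] E n) := by
        refine ⟨fun x => ⟨x, rfl⟩, ?_⟩
        rintro _ ⟨x, rfl⟩
        exact DFunLike.congr_fun hP x
      rw [traceCLM_apply]
      exact h1.trace
    ext P
    simp only [mem_ofPred_eq, mem_inter_iff]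
    constructor
    · rintro ⟨h, hd⟩
      exact ⟨⟨h.isIdempotentElem, h.isSelfAdjoint⟩, by rw [key P h.isIdempotentElem, hd]⟩
    · rintro ⟨⟨h1, h2⟩, h3⟩
      exact ⟨⟨h1, h2⟩, by exact_mod_cast (key P h1).symm.trans h3⟩
  refine (isCompact_iff_compactSpace (s := {P : E n →L[ℝ] E n |
    IsStarProjection P ∧ Module.finrank ℝ P.range = d})).mp ?_
  refine Metric.isCompact_of_isClosed_isBounded ?_ ?_
  · rw [hset]
    exact ((isClosed_eq (continuous_id.mul continuous_id) continuous_id).inter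
      (isClosed_eq continuous_star_clm continuous_id)).inter
      (isClosed_eq (traceCLM n).continuous continuous_const)
  · refine (Metric.isBounded_closedBall (x := (0 : E n →L[ℝ] E n)) (r := 1)).subset fun P hP => ?_
    rw [mem_closedBall_zero_iff]
    exact hP.1.norm_le

end ApproxMCF

namespace ApproxMCF
variable {n d : ℕ}

/-! ### The kernel -/

variable {ψ : E n → ℝ} {ε : ℝ}

lemma contDiff_kernel (hψ : IsCutoff ψ) : ContDiff ℝ 1 (kernel ψ ε) := by
  have h1 : ContDiff ℝ 1 ψ := hψ.smooth.of_le (by exact_mod_cast le_top)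
  unfold kernel gaussianKernel
  refine contDiff_const.mul (h1.mul (contDiff_const.mul (Real.contDiff_exp.comp ?_)))
  exact ((contDiff_norm_sq ℝ).neg).div_const _

lemma kernel_eq_zero (hψ : IsCutoff ψ) {x : E n} (hx : 1 ≤ ‖x‖) : kernel ψ ε x = 0 := by
  rw [kernel, hψ.eq_zero x hx, zero_mul, mul_zero]

lemma gaussianKernel_nonneg (x : E n) : 0 ≤ gaussianKernel ε x := by
  unfold gaussianKernel
  positivity

lemma kernel_nonneg (hψ : IsCutoff ψ) (x : E n) : 0 ≤ kernel ψ ε x :=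
  mul_nonneg (one_div_nonneg.mpr (integral_nonneg fun z =>
    mul_nonneg (hψ.nonneg z) (gaussianKernel_nonneg z)))
    (mul_nonneg (hψ.nonneg x) (gaussianKernel_nonneg x))

lemma hasCompactSupport_kernel (hψ : IsCutoff ψ) : HasCompactSupport (kernel ψ ε) := by
  refine HasCompactSupport.intro (isCompact_closedBall (0 : E n) 1) fun x hx => ?_
  rw [mem_closedBall_zero_iff, not_le] at hx
  exact kernel_eq_zero hψ hx.le

lemma fderiv_kernel_eq_zero (hψ : IsCutoff ψ) {x : E n} (hx : 1 < ‖x‖) :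
    fderiv ℝ (kernel ψ ε) x = 0 := by
  have h : kernel ψ ε =ᶠ[𝓝 x] fun _ => 0 := by
    filter_upwards [continuous_norm.continuousAt.eventually (lt_mem_nhds hx)] with y hy
    exact kernel_eq_zero hψ (le_of_lt hy)
  rw [h.fderiv_eq, fderiv_fun_const]
  rfl

lemma continuous_fderiv_kernel (hψ : IsCutoff ψ) : Continuous (fderiv ℝ (kernel ψ ε)) :=
  (contDiff_kernel hψ).continuous_fderiv one_ne_zero

lemma norm_gradient_kernel (x : E n) :
    ‖gradient (kernel ψ ε) x‖ = ‖fderiv ℝ (kernel ψ ε) x‖ :=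
  (InnerProductSpace.toDual ℝ (E n)).symm.norm_map _

lemma inner_gradient_kernel (x v : E n) :
    inner ℝ (gradient (kernel ψ ε) x) v = fderiv ℝ (kernel ψ ε) x v :=
  InnerProductSpace.toDual_symm_apply

lemma continuous_gradient_kernel (hψ : IsCutoff ψ) : Continuous (gradient (kernel ψ ε)) :=
  (InnerProductSpace.toDual ℝ (E n)).symm.continuous.comp (continuous_fderiv_kernel hψ)

lemma gradient_kernel_eq_zero (hψ : IsCutoff ψ) {x : E n} (hx : 1 < ‖x‖) :
    gradient (kernel ψ ε) x = 0 := by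
  rw [← norm_eq_zero, norm_gradient_kernel, fderiv_kernel_eq_zero hψ hx, norm_zero]

/-- The largest slope of the kernel. -/
noncomputable def slopeBound (ψ : E n → ℝ) (ε : ℝ) : ℝ := ⨆ x, ‖gradient (kernel ψ ε) x‖

lemma norm_gradient_le (hψ : IsCutoff ψ) (x : E n) :
    ‖gradient (kernel ψ ε) x‖ ≤ slopeBound ψ ε := by
  refine le_ciSup (f := fun x => ‖gradient (kernel ψ ε) x‖) ?_ x
  -- Boundedness is needed for the supremum to be a genuine one, not the default value 0.
  have h : HasCompactSupport (gradient (kernel ψ ε)) := by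
    refine HasCompactSupport.intro (isCompact_closedBall (0 : E n) 1) fun x hx => ?_
    rw [mem_closedBall_zero_iff, not_le] at hx
    exact gradient_kernel_eq_zero hψ hx
  obtain ⟨C, hC⟩ := h.exists_bound_of_continuous (continuous_gradient_kernel hψ)
  exact ⟨C, by rintro _ ⟨y, rfl⟩; exact hC y⟩

lemma slopeBound_nonneg : 0 ≤ slopeBound ψ ε := Real.iSup_nonneg fun _ => norm_nonneg _

/-! ### Varifolds with bounded mass and support -/

/-- The mass of `V` is at most `M`, and `V` is supported in the ball of radius `R`. -/
structure Confined (V : VMeasure n d) (M R : ℝ) : Prop where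
  le_mass : V univ ≤ ENNReal.ofReal M
  outside : V {p | R < ‖p.1‖} = 0

namespace Confined

variable {V : VMeasure n d} {M R : ℝ}

lemma isFiniteMeasure (h : Confined V M R) : IsFiniteMeasure V :=
  ⟨h.le_mass.trans_lt ENNReal.ofReal_lt_top⟩

lemma real_le (h : Confined V M R) (hM : 0 ≤ M) : V.real univ ≤ M :=
  ENNReal.toReal_le_of_le_ofReal hM h.le_mass

lemma ae_norm_le (h : Confined V M R) : ∀ᵐ p ∂V, ‖p.1‖ ≤ R := by
  rw [ae_iff]
  simpa only [not_le] using h.outside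

lemma mono {M' R' : ℝ} (h : Confined V M R) (hM : M ≤ M') (hR : R ≤ R') : Confined V M' R' :=
  ⟨h.le_mass.trans (ENNReal.ofReal_le_ofReal hM),
    measure_mono_null (fun _ hp => lt_of_le_of_lt hR hp) h.outside⟩

end Confined

lemma mass_univ (V : VMeasure n d) : mass V univ = V univ := by
  rw [mass, Measure.map_apply measurable_fst MeasurableSet.univ, preimage_univ]

lemma mass_real_univ (V : VMeasure n d) : (mass V).real univ = V.real univ := by
  rw [Measure.real, Measure.real, mass_univ]

/-! ### Regularized mass and first variation -/

lemma convMass_eq (hψ : IsCutoff ψ) (V : VMeasure n d) (x : E n) :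
    convMass ψ ε V x = ∫ p, kernel ψ ε (p.1 - x) ∂V := by
  have hc : Continuous fun y : E n => kernel ψ ε (y - x) :=
    (contDiff_kernel hψ).continuous.comp (continuous_id.sub continuous_const)
  rw [convMass, mass, integral_map measurable_fst.aemeasurable hc.aestronglyMeasurable]

lemma convMass_nonneg (hψ : IsCutoff ψ) (V : VMeasure n d) (x : E n) : 0 ≤ convMass ψ ε V x :=
  integral_nonneg fun _ => kernel_nonneg hψ _

lemma continuous_convMass (hψ : IsCutoff ψ) (V : VMeasure n d) [IsFiniteMeasure V] :
    Continuous (convMass ψ ε V) := by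
  have hk := (contDiff_kernel (ε := ε) hψ).continuous
  obtain ⟨C, hC⟩ := (hasCompactSupport_kernel (ε := ε) hψ).exists_bound_of_continuous hk
  simp_rw [funext (convMass_eq (ε := ε) hψ V)]
  refine continuous_of_dominated (bound := fun _ => C) (fun x => ?_) (fun x => ?_)
    (integrable_const _) ?_
  · exact (hk.comp (continuous_fst.sub continuous_const)).aestronglyMeasurable
  · exact ae_of_all _ fun p => hC _
  · exact ae_of_all _ fun p => hk.comp (continuous_const.sub continuous_id)

lemma continuous_plane_gradient (hψ : IsCutoff ψ) :
    Continuous fun q : (E n × Grass n d) × E n =>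
      q.1.2.1 (gradient (kernel ψ ε) (q.1.1 - q.2)) :=
  (continuous_subtype_val.comp (continuous_snd.comp continuous_fst)).clm_apply
    ((continuous_gradient_kernel hψ).comp
      ((continuous_fst.comp continuous_fst).sub continuous_snd))

lemma norm_plane_gradient_le (hψ : IsCutoff ψ) (p : E n × Grass n d) (x : E n) :
    ‖p.2.1 (gradient (kernel ψ ε) (p.1 - x))‖ ≤ slopeBound ψ ε :=
  (p.2.norm_apply_le _).trans (norm_gradient_le hψ _)

lemma continuous_convFirstVar (hψ : IsCutoff ψ) (V : VMeasure n d) [IsFiniteMeasure V] :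
    Continuous (convFirstVar ψ ε V) := by
  refine continuous_of_dominated (bound := fun _ => slopeBound ψ ε) (fun x => ?_) (fun x => ?_)
    (integrable_const _) ?_
  · exact ((continuous_plane_gradient hψ).comp
      (continuous_id.prodMk continuous_const)).aestronglyMeasurable
  · exact ae_of_all _ fun p => norm_plane_gradient_le hψ p x
  · exact ae_of_all _ fun p => (continuous_plane_gradient hψ).comp
      (continuous_const.prodMk continuous_id)

lemma norm_convFirstVar_le (hψ : IsCutoff ψ) {V : VMeasure n d} {M R : ℝ} (hM : 0 ≤ M)
    (hV : Confined V M R) (x : E n) : ‖convFirstVar ψ ε V x‖ ≤ slopeBound ψ ε * M := by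
  have := hV.isFiniteMeasure
  refine (norm_integral_le_of_norm_le_const
    (ae_of_all _ fun p => norm_plane_gradient_le hψ p x)).trans ?_
  exact mul_le_mul_of_nonneg_left (hV.real_le hM) slopeBound_nonneg

lemma convFirstVar_eq_zero (hψ : IsCutoff ψ) {V : VMeasure n d} {M R : ℝ}
    (hV : Confined V M R) {x : E n} (hx : R + 1 < ‖x‖) : convFirstVar ψ ε V x = 0 := by
  refine integral_eq_zero_of_ae ?_
  filter_upwards [hV.ae_norm_le] with p hp
  have h1 : 1 < ‖p.1 - x‖ := by
    have := norm_sub_norm_le x p.1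
    rw [norm_sub_rev] at this
    linarith
  simp [gradient_kernel_eq_zero hψ h1]

/-! ### The approximate mean curvature -/

lemma continuous_hTilde (hψ : IsCutoff ψ) (hε : 0 < ε) (V : VMeasure n d) [IsFiniteMeasure V] :
    Continuous (hTilde ψ ε V) := by
  refine (Continuous.smul (Continuous.inv₀ ((continuous_convMass hψ V).add continuous_const)
    fun x => ?_) (continuous_convFirstVar hψ V)).neg
  exact (add_pos_of_nonneg_of_pos (convMass_nonneg hψ V x) hε).ne'

lemma norm_hTilde_le (hψ : IsCutoff ψ) (hε : 0 < ε) {V : VMeasure n d} {M R : ℝ} (hM : 0 ≤ M)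
    (hV : Confined V M R) (x : E n) : ‖hTilde ψ ε V x‖ ≤ ε⁻¹ * (slopeBound ψ ε * M) := by
  have h1 := convMass_nonneg (ε := ε) hψ V x
  rw [hTilde, norm_neg, norm_smul, norm_inv, Real.norm_of_nonneg (by positivity)]
  have h2 := norm_convFirstVar_le (ε := ε) hψ hM hV x
  gcongr
  linarith

lemma hTilde_eq_zero (hψ : IsCutoff ψ) {V : VMeasure n d} {M R : ℝ}
    (hV : Confined V M R) {x : E n} (hx : R + 1 < ‖x‖) : hTilde ψ ε V x = 0 := by
  rw [hTilde, convFirstVar_eq_zero hψ hV hx, smul_zero, neg_zero]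

lemma integrable_hTilde (hψ : IsCutoff ψ) (hε : 0 < ε) {V : VMeasure n d} {M R : ℝ}
    (hV : Confined V M R) : Integrable (hTilde ψ ε V) := by
  have := hV.isFiniteMeasure
  refine (continuous_hTilde hψ hε V).integrable_of_hasCompactSupport ?_
  refine HasCompactSupport.intro (isCompact_closedBall (0 : E n) (R + 1)) fun x hx => ?_
  rw [mem_closedBall_zero_iff, not_le] at hx
  exact hTilde_eq_zero hψ hV hx

/-- The approximate curvature unfolds to a convolution for the flipped scalar multiplication, with
the kernel as second factor; the derivative falls on the kernel, and `hTilde` need only be locally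
integrable. -/
lemma hasFDerivAt_approxCurvature (hψ : IsCutoff ψ) (hε : 0 < ε) {V : VMeasure n d} {M R : ℝ}
    (hV : Confined V M R) (x : E n) :
    HasFDerivAt (approxCurvature ψ ε V)
      (∫ y, (fderiv ℝ (kernel ψ ε) (x - y)).smulRight (hTilde ψ ε V y)) x := by
  have h := (hasCompactSupport_kernel (ε := ε) hψ).hasFDerivAt_convolution_right
    (ContinuousLinearMap.lsmul ℝ ℝ).flip (integrable_hTilde hψ hε hV).locallyIntegrable
    (contDiff_kernel hψ) x
  exact h

lemma contDiff_approxCurvature (hψ : IsCutoff ψ) (hε : 0 < ε) {V : VMeasure n d} {M R : ℝ}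
    (hV : Confined V M R) : ContDiff ℝ 1 (approxCurvature ψ ε V) := by
  exact_mod_cast (hasCompactSupport_kernel (ε := ε) hψ).contDiff_convolution_right
    (n := 1) (ContinuousLinearMap.lsmul ℝ ℝ).flip (integrable_hTilde hψ hε hV).locallyIntegrable
    (by exact_mod_cast contDiff_kernel hψ)

/-- The constant depends on the mass bound but not on the radius `R`, so the step size threshold can
be fixed while the supports spread. The `+ 1` in the witness only makes it positive. -/
lemma exists_curvature_bound (hψ : IsCutoff ψ) (hε : 0 < ε) (d : ℕ) {M : ℝ} (hM : 0 ≤ M) :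
    ∃ C > 0, ∀ (V : VMeasure n d) (R : ℝ), Confined V M R →
      (∀ x, ‖approxCurvature ψ ε V x‖ ≤ C) ∧ ∀ x, ‖fderiv ℝ (approxCurvature ψ ε V) x‖ ≤ C := by
  set H := ε⁻¹ * (slopeBound ψ ε * M)
  have hH : 0 ≤ H := mul_nonneg (by positivity) (mul_nonneg slopeBound_nonneg hM)
  have hk1 : Integrable (fun y => ‖kernel ψ ε y‖) :=
    ((contDiff_kernel (ε := ε) hψ).continuous.integrable_of_hasCompactSupport
      (hasCompactSupport_kernel hψ)).norm
  have hk2 : Integrable (fun y => ‖fderiv ℝ (kernel ψ ε) y‖) :=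
    ((continuous_fderiv_kernel (ε := ε) hψ).integrable_of_hasCompactSupport
      ((hasCompactSupport_kernel hψ).fderiv ℝ)).norm
  set A := ∫ y, ‖kernel ψ ε y‖ with hA
  set B := ∫ y, ‖fderiv ℝ (kernel ψ ε) y‖ with hB
  have hA0 : 0 ≤ A := integral_nonneg fun _ => norm_nonneg _
  have hB0 : 0 ≤ B := integral_nonneg fun _ => norm_nonneg _
  refine ⟨A * H + B * H + 1, by positivity, fun V R hV => ⟨fun x => ?_, fun x => ?_⟩⟩
  · have h1 : ‖approxCurvature ψ ε V x‖ ≤ ∫ y, ‖kernel ψ ε (x - y)‖ * H := by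
      refine norm_integral_le_of_norm_le ((hk1.comp_sub_left x).mul_const H) ?_
      refine ae_of_all _ fun y => ?_
      rw [norm_smul]
      exact mul_le_mul_of_nonneg_left (norm_hTilde_le hψ hε hM hV y) (norm_nonneg _)
    rw [integral_mul_const, integral_sub_left_eq_self (fun y => ‖kernel ψ ε y‖)] at h1
    have : 0 ≤ B * H := by positivity
    linarith
  · have h1 : ‖fderiv ℝ (approxCurvature ψ ε V) x‖
        ≤ ∫ y, ‖fderiv ℝ (kernel ψ ε) (x - y)‖ * H := by
      rw [(hasFDerivAt_approxCurvature hψ hε hV x).fderiv]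
      refine norm_integral_le_of_norm_le ((hk2.comp_sub_left x).mul_const H) ?_
      refine ae_of_all _ fun y => ?_
      rw [ContinuousLinearMap.norm_smulRight_apply]
      exact mul_le_mul_of_nonneg_left (norm_hTilde_le hψ hε hM hV y) (norm_nonneg _)
    rw [integral_mul_const, integral_sub_left_eq_self (fun y => ‖fderiv ℝ (kernel ψ ε) y‖)] at h1
    have : 0 ≤ A * H := by positivity
    linarith

/-! ### The dissipation -/

/-- The space integral of the dissipation density. -/
noncomputable def dissipation (ψ : E n → ℝ) (ε : ℝ) (V : VMeasure n d) : ℝ :=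
  ∫ y, dissipationDensity ψ ε V y

lemma dissipationDensity_nonneg (hψ : IsCutoff ψ) (hε : 0 < ε) (V : VMeasure n d) (y : E n) :
    0 ≤ dissipationDensity ψ ε V y := by
  have := convMass_nonneg (ε := ε) hψ V y
  unfold dissipationDensity
  positivity

lemma continuous_dissipationDensity (hψ : IsCutoff ψ) (hε : 0 < ε) (V : VMeasure n d)
    [IsFiniteMeasure V] : Continuous (dissipationDensity ψ ε V) := by
  refine ((continuous_convFirstVar hψ V).norm.pow 2).div
    ((continuous_convMass hψ V).add continuous_const) fun x => ?_
  have := convMass_nonneg (ε := ε) hψ V x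
  positivity

/-- One integrable majorant for all varifolds with the same mass and support bounds, as dominated
convergence requires. -/
lemma dissipationDensity_le (hψ : IsCutoff ψ) (hε : 0 < ε) {V : VMeasure n d} {M R : ℝ}
    (hM : 0 ≤ M) (hV : Confined V M R) (y : E n) :
    dissipationDensity ψ ε V y ≤
      (Metric.closedBall (0 : E n) (R + 1)).indicator
        (fun _ => (slopeBound ψ ε * M) ^ 2 / ε) y := by
  have h1 := convMass_nonneg (ε := ε) hψ V y
  by_cases hy : y ∈ Metric.closedBall (0 : E n) (R + 1)
  · rw [indicator_of_mem hy, dissipationDensity]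
    have := norm_convFirstVar_le (ε := ε) hψ hM hV y
    gcongr
    linarith
  · rw [indicator_of_notMem hy, dissipationDensity]
    rw [mem_closedBall_zero_iff, not_le] at hy
    simp [convFirstVar_eq_zero hψ hV hy]

lemma integrable_indicator_closedBall (R c : ℝ) :
    Integrable ((Metric.closedBall (0 : E n) R).indicator (fun _ => c)) :=
  (integrable_indicator_iff measurableSet_closedBall).mpr
    (integrableOn_const measure_closedBall_lt_top.ne)

lemma integrable_dissipationDensity (hψ : IsCutoff ψ) (hε : 0 < ε) {V : VMeasure n d} {M R : ℝ}
    (hM : 0 ≤ M) (hV : Confined V M R) : Integrable (dissipationDensity ψ ε V) := by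
  have := hV.isFiniteMeasure
  refine (integrable_indicator_closedBall (R + 1) ((slopeBound ψ ε * M) ^ 2 / ε)).mono'
    (continuous_dissipationDensity hψ hε V).aestronglyMeasurable (ae_of_all _ fun y => ?_)
  rw [Real.norm_of_nonneg (dissipationDensity_nonneg hψ hε V y)]
  exact dissipationDensity_le hψ hε hM hV y

lemma dissipation_nonneg (hψ : IsCutoff ψ) (hε : 0 < ε) (V : VMeasure n d) :
    0 ≤ dissipation ψ ε V := integral_nonneg fun y => dissipationDensity_nonneg hψ hε V y

lemma exists_dissipation_bound (hψ : IsCutoff ψ) (hε : 0 < ε) (d : ℕ) {M : ℝ} (hM : 0 ≤ M)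
    (R : ℝ) : ∃ C, ∀ V : VMeasure n d, Confined V M R → dissipation ψ ε V ≤ C :=
  ⟨_, fun _ hV => integral_mono (integrable_dissipationDensity hψ hε hM hV)
    (integrable_indicator_closedBall (R + 1) ((slopeBound ψ ε * M) ^ 2 / ε))
    (dissipationDensity_le hψ hε hM hV)⟩

lemma traceCLM_mul_smulRight (S : Grass n d) (ℓ : E n →L[ℝ] ℝ) (w : E n) :
    traceCLM n (S.1 * ℓ.smulRight w) = ℓ (S.1 w) := by
  rw [← traceCLM_smulRight]
  congr 1
  refine ContinuousLinearMap.ext fun x => ?_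
  exact map_smul S.1 (ℓ x) w

lemma traceCLM_mul_smul (A B : E n →L[ℝ] E n) (τ : ℝ) :
    traceCLM n (A * (τ • B)) = τ * traceCLM n (A * B) := by
  have h : A * (τ • B) = τ • (A * B) := ContinuousLinearMap.ext fun x => map_smul A τ (B x)
  rw [h]
  exact map_smul (traceCLM n) τ _

/-- The first variation of `V` at the approximate mean curvature is minus the dissipation. -/
lemma integral_trace_fderiv_approxCurvature (hψ : IsCutoff ψ) (hε : 0 < ε) {V : VMeasure n d}
    {M R : ℝ} (hV : Confined V M R) :
    ∫ p, traceCLM n (p.2.1 * fderiv ℝ (approxCurvature ψ ε V) p.1) ∂V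
      = -dissipation ψ ε V := by
  have := hV.isFiniteMeasure
  have hT := continuous_hTilde hψ hε V
  have hTi := integrable_hTilde hψ hε hV
  have h1 : ∀ p : E n × Grass n d,
      traceCLM n (p.2.1 * fderiv ℝ (approxCurvature ψ ε V) p.1)
        = ∫ y, inner ℝ (p.2.1 (gradient (kernel ψ ε) (p.1 - y))) (hTilde ψ ε V y) := by
    intro p
    rw [(hasFDerivAt_approxCurvature hψ hε hV p.1).fderiv]
    have hi : Integrable fun y =>
        (fderiv ℝ (kernel ψ ε) (p.1 - y)).smulRight (hTilde ψ ε V y) := by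
      refine (hTi.norm.const_mul (slopeBound ψ ε)).mono' ?_ (ae_of_all _ fun y => ?_)
      · have hc : Continuous fun y =>
            (fderiv ℝ (kernel ψ ε) (p.1 - y)).smulRight (hTilde ψ ε V y) :=
          ((ContinuousLinearMap.smulRightL ℝ (E n) (E n)).continuous.comp
            ((continuous_fderiv_kernel hψ).comp (continuous_const.sub continuous_id))).clm_apply hT
        exact hc.aestronglyMeasurable
      · rw [ContinuousLinearMap.norm_smulRight_apply, ← norm_gradient_kernel]
        exact mul_le_mul_of_nonneg_right (norm_gradient_le hψ _) (norm_nonneg _)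
    have h2 := ((traceCLM n) ∘L (ContinuousLinearMap.compL ℝ (E n) (E n) (E n) p.2.1)).integral_comp_comm hi
    refine Eq.trans h2.symm (integral_congr_ae (ae_of_all _ fun y => ?_))
    change traceCLM n (p.2.1 * (fderiv ℝ (kernel ψ ε) (p.1 - y)).smulRight (hTilde ψ ε V y)) = _
    rw [traceCLM_mul_smulRight, ← inner_gradient_kernel]
    exact (p.2.inner_left _ _).symm
  simp_rw [h1]
  -- Integrating over the varifold first, with `y` fixed, produces `convFirstVar` at `y`; the
  -- argument of the gradient already has the right sign, so no symmetry of the kernel is needed.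
  rw [integral_integral_swap]
  · rw [dissipation, ← integral_neg]
    refine integral_congr_ae (ae_of_all _ fun y => ?_)
    have hi : Integrable (fun p : E n × Grass n d =>
        p.2.1 (gradient (kernel ψ ε) (p.1 - y))) V := by
      refine Integrable.of_bound ((continuous_plane_gradient hψ).comp
        (continuous_id.prodMk continuous_const)).aestronglyMeasurable (slopeBound ψ ε) ?_
      exact ae_of_all _ fun p => norm_plane_gradient_le hψ p y
    have h3 := integral_inner (𝕜 := ℝ) hi (hTilde ψ ε V y)
    simp only
    simp_rw [real_inner_comm (hTilde ψ ε V y)]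
    rw [h3]
    change inner ℝ (hTilde ψ ε V y) (convFirstVar ψ ε V y) = _
    rw [hTilde, inner_neg_left, real_inner_smul_left, real_inner_self_eq_norm_sq,
      dissipationDensity, div_eq_inv_mul]
  · have hc : Continuous fun q : (E n × Grass n d) × E n =>
        inner ℝ (q.1.2.1 (gradient (kernel ψ ε) (q.1.1 - q.2))) (hTilde ψ ε V q.2) :=
      (continuous_plane_gradient hψ).inner (hT.comp continuous_snd)
    refine ((integrable_const (μ := V) (slopeBound ψ ε)).mul_prod hTi.norm).mono'
      hc.aestronglyMeasurable (ae_of_all _ fun q => ?_)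
    refine (norm_inner_le_norm _ _).trans ?_
    exact mul_le_mul_of_nonneg_right (norm_plane_gradient_le hψ _ _) (norm_nonneg _)

end ApproxMCF

namespace ApproxMCF
variable {n d : ℕ} {ψ : E n → ℝ} {ε : ℝ}

/-! ### One step of the time-discrete flow -/

/-- The map of `E n × Grass n d` induced by `id + τ h_ε(·, V)`. -/
noncomputable def stepMap (ψ : E n → ℝ) (ε τ : ℝ) (V : VMeasure n d) (p : E n × Grass n d) :
    E n × Grass n d :=
  (p.1 + τ • approxCurvature ψ ε V p.1,
    imagePlane (1 + τ • fderiv ℝ (approxCurvature ψ ε V) p.1) p.2)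

/-- The tangential Jacobian of `id + τ h_ε(·, V)`. -/
noncomputable def stepJacobian (ψ : E n → ℝ) (ε τ : ℝ) (V : VMeasure n d)
    (p : E n × Grass n d) : ℝ :=
  tangentialJacobian (1 + τ • fderiv ℝ (approxCurvature ψ ε V) p.1) p.2

lemma stepJacobian_nonneg {τ : ℝ} {V : VMeasure n d} (p : E n × Grass n d) :
    0 ≤ stepJacobian ψ ε τ V p := tangentialJacobian_nonneg _ _

lemma norm_smul_clm_le {A : E n →L[ℝ] E n} {τ C : ℝ} (hτ : 0 ≤ τ) (hA : ‖A‖ ≤ C) :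
    ‖τ • A‖ ≤ τ * C := by
  refine (norm_smul_le τ A).trans ?_
  rw [Real.norm_of_nonneg hτ]
  gcongr

lemma fderiv_id_add_smul (hψ : IsCutoff ψ) (hε : 0 < ε) {V : VMeasure n d} {M R : ℝ}
    (hV : Confined V M R) (τ : ℝ) (x : E n) :
    fderiv ℝ (fun x => x + τ • approxCurvature ψ ε V x) x
      = 1 + τ • fderiv ℝ (approxCurvature ψ ε V) x := by
  have h := ((contDiff_approxCurvature hψ hε hV).differentiable one_ne_zero x).hasFDerivAt
  exact ((hasFDerivAt_id x).add (h.const_smul τ)).fderiv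

lemma step_eq (hψ : IsCutoff ψ) (hε : 0 < ε) {V : VMeasure n d} {M R : ℝ}
    (hV : Confined V M R) (τ : ℝ) :
    step ψ ε τ V
      = (V.withDensity fun p => ENNReal.ofReal (stepJacobian ψ ε τ V p)).map
          (stepMap ψ ε τ V) := by
  rw [step, pushforward]
  simp_rw [fderiv_id_add_smul hψ hε hV τ]
  rfl

lemma continuous_one_add_smul_fderiv (hψ : IsCutoff ψ) (hε : 0 < ε) {V : VMeasure n d} {M R : ℝ}
    (hV : Confined V M R) (τ : ℝ) :
    Continuous fun p : E n × Grass n d => 1 + τ • fderiv ℝ (approxCurvature ψ ε V) p.1 :=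
  continuous_const.add ((((contDiff_approxCurvature hψ hε hV).continuous_fderiv
    one_ne_zero).comp continuous_fst).const_smul τ)

lemma continuous_stepJacobian (hψ : IsCutoff ψ) (hε : 0 < ε) {V : VMeasure n d} {M R : ℝ}
    (hV : Confined V M R) (τ : ℝ) : Continuous (stepJacobian ψ ε τ V) :=
  continuous_tangentialJacobian (continuous_one_add_smul_fderiv hψ hε hV τ) continuous_snd

lemma continuous_stepMap (hψ : IsCutoff ψ) (hε : 0 < ε) {V : VMeasure n d} {M R C τ : ℝ}
    (hV : Confined V M R) (hC : ∀ x, ‖fderiv ℝ (approxCurvature ψ ε V) x‖ ≤ C)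
    (hτ : 0 ≤ τ) (hτC : τ * C ≤ 1 / 2) : Continuous (stepMap ψ ε τ V) := by
  have h := (contDiff_approxCurvature hψ hε hV).continuous
  refine (continuous_fst.add ((h.comp continuous_fst).const_smul τ)).prodMk ?_
  exact continuous_imagePlane (continuous_one_add_smul_fderiv hψ hε hV τ) continuous_snd
    fun p => injective_one_add ((norm_smul_clm_le hτ (hC p.1)).trans hτC)

lemma integral_step (hψ : IsCutoff ψ) (hε : 0 < ε) {V : VMeasure n d} {M R C τ : ℝ}
    (hV : Confined V M R) (hC : ∀ x, ‖fderiv ℝ (approxCurvature ψ ε V) x‖ ≤ C)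
    (hτ : 0 ≤ τ) (hτC : τ * C ≤ 1 / 2) {φ : E n × Grass n d → ℝ} (hφ : Continuous φ) :
    ∫ p, φ p ∂(step ψ ε τ V)
      = ∫ p, stepJacobian ψ ε τ V p * φ (stepMap ψ ε τ V p) ∂V := by
  have hm := (continuous_stepMap hψ hε hV hC hτ hτC).measurable
  have hJ := (continuous_stepJacobian hψ hε hV τ).measurable
  rw [step_eq hψ hε hV, integral_map hm.aemeasurable hφ.aestronglyMeasurable,
    integral_withDensity_eq_integral_toReal_smul hJ.ennreal_ofReal
      (ae_of_all _ fun _ => ENNReal.ofReal_lt_top)]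
  refine integral_congr_ae (ae_of_all _ fun p => ?_)
  simp only [smul_eq_mul]
  rw [ENNReal.toReal_ofReal (stepJacobian_nonneg p)]

lemma step_univ (hψ : IsCutoff ψ) (hε : 0 < ε) {V : VMeasure n d} {M R C τ : ℝ}
    (hV : Confined V M R) (hC : ∀ x, ‖fderiv ℝ (approxCurvature ψ ε V) x‖ ≤ C)
    (hτ : 0 ≤ τ) (hτC : τ * C ≤ 1 / 2) :
    step ψ ε τ V univ = ∫⁻ p, ENNReal.ofReal (stepJacobian ψ ε τ V p) ∂V := by
  have hm := (continuous_stepMap hψ hε hV hC hτ hτC).measurable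
  rw [step_eq hψ hε hV, Measure.map_apply hm MeasurableSet.univ, preimage_univ,
    withDensity_apply _ MeasurableSet.univ, Measure.restrict_univ]

lemma step_outside (hψ : IsCutoff ψ) (hε : 0 < ε) {V : VMeasure n d} {M R C τ : ℝ}
    (hV : Confined V M R) (hC : ∀ x, ‖fderiv ℝ (approxCurvature ψ ε V) x‖ ≤ C)
    (hC' : ∀ x, ‖approxCurvature ψ ε V x‖ ≤ C)
    (hτ : 0 ≤ τ) (hτC : τ * C ≤ 1 / 2) :
    step ψ ε τ V {p | R + τ * C < ‖p.1‖} = 0 := by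
  have hm := (continuous_stepMap hψ hε hV hC hτ hτC).measurable
  rw [step_eq hψ hε hV, Measure.map_apply hm
    (measurableSet_lt measurable_const measurable_fst.norm)]
  refine (withDensity_absolutelyContinuous V _) (measure_mono_null (fun p hp => ?_) hV.outside)
  have h1 : R + τ * C < ‖p.1 + τ • approxCurvature ψ ε V p.1‖ := hp
  have h2 := norm_add_le p.1 (τ • approxCurvature ψ ε V p.1)
  have h3 : ‖τ • approxCurvature ψ ε V p.1‖ ≤ τ * C := by
    rw [norm_smul, Real.norm_of_nonneg hτ]
    exact mul_le_mul_of_nonneg_left (hC' _) hτ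
  change R < ‖p.1‖
  linarith

lemma abs_trace_mul_le (S : Grass n d) (B : E n →L[ℝ] E n) :
    |traceCLM n (S.1 * B)| ≤ ‖traceCLM n‖ * ‖B‖ := by
  refine ((traceCLM n).le_opNorm _).trans ?_
  gcongr
  refine (norm_mul_le _ _).trans ?_
  have := S.norm_le
  have := norm_nonneg B
  nlinarith

lemma exists_tangentialJacobian_bound (n d : ℕ) :
    ∃ K ≥ 0, ∃ δ > 0, ∀ (B : E n →L[ℝ] E n) (S : Grass n d), ‖B‖ ≤ δ →
      |tangentialJacobian (1 + B) S - 1| ≤ K * ‖B‖ := by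
  obtain ⟨δ, hδ, h⟩ := tangentialJacobian_expansion (n := n) (d := d) one_pos
  refine ⟨‖traceCLM n‖ + 1, add_nonneg (norm_nonneg (traceCLM n)) zero_le_one, δ, hδ,
    fun B S hB => ?_⟩
  have h1 := h B S hB
  have h2 := abs_trace_mul_le S B
  rw [abs_le] at h1 h2 ⊢
  constructor <;> linarith [h1.1, h1.2, h2.1, h2.2]

/-- The first order expansion of the mass in one step, uniform among confined varifolds. -/
lemma exists_mass_step_expansion (hψ : IsCutoff ψ) (hε : 0 < ε) (d : ℕ) {M : ℝ} (hM : 0 ≤ M)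
    {η : ℝ} (hη : 0 < η) :
    ∃ τ₀ > 0, ∀ (τ : ℝ) (V : VMeasure n d) (R : ℝ), 0 ≤ τ → τ ≤ τ₀ → Confined V M R →
      IsFiniteMeasure (step ψ ε τ V) ∧
      |(step ψ ε τ V).real univ - V.real univ + τ * dissipation ψ ε V| ≤ η * τ := by
  obtain ⟨C, hC0, hC⟩ := exists_curvature_bound (n := n) hψ hε d hM
  -- `C` offsets the bound `τ C` on the perturbation, and `M + 1`, rather than a possibly zero `M`,
  -- offsets the mass in the final integration.
  obtain ⟨δ, hδ, hexp⟩ := tangentialJacobian_expansion (n := n) (d := d)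
    (η := η / (C * (M + 1))) (by positivity)
  refine ⟨min (δ / C) (1 / 2 / C), by positivity, fun τ V R hτ0 hτ hV => ?_⟩
  have := hV.isFiniteMeasure
  have hτ1 : τ * C ≤ δ := (le_div_iff₀ hC0).mp (hτ.trans (min_le_left _ _))
  have hτ2 : τ * C ≤ 1 / 2 := (le_div_iff₀ hC0).mp (hτ.trans (min_le_right _ _))
  obtain ⟨-, hD⟩ := hC V R hV
  set T : E n × Grass n d → ℝ := fun p => traceCLM n (p.2.1 * fderiv ℝ (approxCurvature ψ ε V) p.1)
  have hpt : ∀ p, ‖stepJacobian ψ ε τ V p - 1 - τ * T p‖ ≤ η / (M + 1) * τ := fun p => by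
    have h1 := norm_smul_clm_le hτ0 (hD p.1)
    have h2 := hexp (τ • fderiv ℝ (approxCurvature ψ ε V) p.1) p.2 (h1.trans hτ1)
    rw [traceCLM_mul_smul] at h2
    refine h2.trans ?_
    calc η / (C * (M + 1)) * ‖τ • fderiv ℝ (approxCurvature ψ ε V) p.1‖
        ≤ η / (C * (M + 1)) * (τ * C) := by gcongr
      _ = η / (M + 1) * τ := by field_simp
  have hTc : Continuous T := (traceCLM n).continuous.comp
    ((continuous_subtype_val.comp continuous_snd).mul
      (((contDiff_approxCurvature hψ hε hV).continuous_fderiv one_ne_zero).comp continuous_fst))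
  have hTi : Integrable T V := Integrable.of_bound hTc.aestronglyMeasurable (‖traceCLM n‖ * C)
    (ae_of_all _ fun p => (abs_trace_mul_le p.2 _).trans
      (mul_le_mul_of_nonneg_left (hD p.1) (norm_nonneg (traceCLM n))))
  have hi1 : Integrable (fun p => stepJacobian ψ ε τ V p - 1 - τ * T p) V :=
    Integrable.of_bound (((continuous_stepJacobian hψ hε hV τ).sub continuous_const).sub
      (continuous_const.mul hTc)).aestronglyMeasurable _ (ae_of_all _ hpt)
  have hJi : Integrable (stepJacobian ψ ε τ V) V := by
    have := (hi1.add (hTi.const_mul τ)).add (integrable_const (1 : ℝ))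
    refine this.congr (ae_of_all _ fun p => ?_)
    simp only [Pi.add_apply]
    ring
  refine ⟨⟨?_⟩, ?_⟩
  · rw [step_univ hψ hε hV hD hτ0 hτ2]
    exact hJi.lintegral_lt_top
  have h1 : (step ψ ε τ V).real univ = ∫ p, stepJacobian ψ ε τ V p ∂V := by
    have := integral_step hψ hε hV hD hτ0 hτ2 (continuous_const (y := (1 : ℝ)))
    simpa using this
  have h2 : ∫ p, (stepJacobian ψ ε τ V p - 1 - τ * T p) ∂V
      = (step ψ ε τ V).real univ - V.real univ + τ * dissipation ψ ε V := by
    have hi2 : Integrable (fun p => stepJacobian ψ ε τ V p - 1) V := hJi.sub (integrable_const _)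
    rw [integral_sub hi2 (hTi.const_mul τ),
      integral_sub hJi (integrable_const _), integral_const_mul,
      integral_trace_fderiv_approxCurvature hψ hε hV, h1]
    simp
  rw [← h2, ← Real.norm_eq_abs]
  refine (norm_integral_le_of_norm_le_const (ae_of_all _ hpt)).trans ?_
  have h3 : V.real univ ≤ M + 1 := (hV.real_le hM).trans (by linarith)
  calc η / (M + 1) * τ * V.real univ ≤ η / (M + 1) * τ * (M + 1) := by gcongr
    _ = η * τ := by field_simp

/-- One short step changes the integral of a test function by little, uniformly among confined
varifolds. -/
lemma exists_test_step_bound (hψ : IsCutoff ψ) (hε : 0 < ε) {M : ℝ} (hM : 0 ≤ M)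
    {φ : E n × Grass n d → ℝ} (hφ : Continuous φ) (hφc : HasCompactSupport φ)
    {η : ℝ} (hη : 0 < η) :
    ∃ τ₀ > 0, ∀ (τ : ℝ) (V : VMeasure n d) (R : ℝ), 0 ≤ τ → τ ≤ τ₀ → Confined V M R →
      |∫ p, φ p ∂(step ψ ε τ V) - ∫ p, φ p ∂V| ≤ η := by
  obtain ⟨C, hC0, hC⟩ := exists_curvature_bound (n := n) hψ hε d hM
  obtain ⟨K, hK, δ, hδ, hJ⟩ := exists_tangentialJacobian_bound n d
  obtain ⟨b, hb⟩ := hφc.exists_bound_of_continuous hφ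
  have hb0 : 0 ≤ |b| := abs_nonneg b
  set η' := η / (2 * (M + 1)) with hη'
  have hη'0 : 0 < η' := by positivity
  obtain ⟨ρ, hρ, hu⟩ := Metric.uniformContinuous_iff.mp
    (hφc.uniformContinuous_of_continuous hφ) η' hη'0
  -- In order: the Jacobian estimate applies; the differential is injective; points move by at most
  -- `ρ/4` and planes by at most `3ρ/4`; the Jacobian contributes at most `η'`.
  refine ⟨min (min (δ / C) (1 / 2 / C)) (min (ρ / 4 / C) (η' / (K * |b| + 1) / C)),
    by positivity, fun τ V R hτ0 hτ hV => ?_⟩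
  have := hV.isFiniteMeasure
  have hτ1 : τ * C ≤ δ := (le_div_iff₀ hC0).mp
    (hτ.trans ((min_le_left _ _).trans (min_le_left _ _)))
  have hτ2 : τ * C ≤ 1 / 2 := (le_div_iff₀ hC0).mp
    (hτ.trans ((min_le_left _ _).trans (min_le_right _ _)))
  have hτ3 : τ * C ≤ ρ / 4 := (le_div_iff₀ hC0).mp
    (hτ.trans ((min_le_right _ _).trans (min_le_left _ _)))
  have hτ4 : τ * C ≤ η' / (K * |b| + 1) := (le_div_iff₀ hC0).mp
    (hτ.trans ((min_le_right _ _).trans (min_le_right _ _)))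
  rw [le_div_iff₀ (by positivity)] at hτ4
  have hτC : 0 ≤ τ * C := by positivity
  obtain ⟨hH, hD⟩ := hC V R hV
  have hpt : ∀ p, ‖stepJacobian ψ ε τ V p * φ (stepMap ψ ε τ V p) - φ p‖ ≤ 2 * η' := fun p => by
    have h1 := norm_smul_clm_le hτ0 (hD p.1)
    have h2 := hJ (τ • fderiv ℝ (approxCurvature ψ ε V) p.1) p.2 (h1.trans hτ1)
    have h3 := dist_imagePlane_le (h1.trans hτ2) p.2
    have h4 : dist (stepMap ψ ε τ V p) p < ρ := by
      rw [Prod.dist_eq]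
      refine max_lt ?_ ?_
      · simp only [stepMap, dist_self_add_left]
        rw [norm_smul, Real.norm_of_nonneg hτ0]
        have := mul_le_mul_of_nonneg_left (hH p.1) hτ0
        linarith
      · refine lt_of_le_of_lt h3 ?_
        linarith
    have h5 := (hu h4).le
    rw [Real.dist_eq] at h5
    have h6 : |φ (stepMap ψ ε τ V p)| ≤ |b| := (hb _).trans (le_abs_self b)
    have h7 : |stepJacobian ψ ε τ V p - 1| ≤ K * (τ * C) := h2.trans (by gcongr)
    have h8 : stepJacobian ψ ε τ V p * φ (stepMap ψ ε τ V p) - φ p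
        = (stepJacobian ψ ε τ V p - 1) * φ (stepMap ψ ε τ V p)
          + (φ (stepMap ψ ε τ V p) - φ p) := by ring
    rw [h8, Real.norm_eq_abs]
    refine (abs_add_le _ _).trans ?_
    rw [abs_mul]
    have h9 : |stepJacobian ψ ε τ V p - 1| * |φ (stepMap ψ ε τ V p)| ≤ K * (τ * C) * |b| := by
      gcongr
    nlinarith
  have hφi : Integrable φ V := Integrable.of_bound hφ.aestronglyMeasurable b (ae_of_all _ hb)
  have hc : Continuous fun p => stepJacobian ψ ε τ V p * φ (stepMap ψ ε τ V p) :=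
    (continuous_stepJacobian hψ hε hV τ).mul
      (hφ.comp (continuous_stepMap hψ hε hV hD hτ0 hτ2))
  have hi : Integrable (fun p => stepJacobian ψ ε τ V p * φ (stepMap ψ ε τ V p)) V := by
    have h1 : Integrable (fun p => stepJacobian ψ ε τ V p * φ (stepMap ψ ε τ V p) - φ p) V :=
      Integrable.of_bound (hc.sub hφ).aestronglyMeasurable _ (ae_of_all _ hpt)
    refine (h1.add hφi).congr (ae_of_all _ fun p => ?_)
    simp only [Pi.add_apply]
    ring
  rw [integral_step hψ hε hV hD hτ0 hτ2 hφ, ← integral_sub hi hφi, ← Real.norm_eq_abs]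
  refine (norm_integral_le_of_norm_le_const (ae_of_all _ hpt)).trans ?_
  have h3 : V.real univ ≤ M + 1 := (hV.real_le hM).trans (by linarith)
  calc 2 * η' * V.real univ ≤ 2 * η' * (M + 1) := by gcongr
    _ = η := by rw [hη']; field_simp

end ApproxMCF

namespace ApproxMCF
variable {n d : ℕ} {ψ : E n → ℝ} {ε : ℝ}

/-! ### Weak limits of confined varifolds -/

lemma hasCompactSupport_of_eq_zero_outside {φ : E n × Grass n d → ℝ} (r : ℝ)
    (h : ∀ p, r < ‖p.1‖ → φ p = 0) : HasCompactSupport φ := by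
  refine HasCompactSupport.intro
    ((isCompact_closedBall (0 : E n) r).prod (isCompact_univ (X := Grass n d))) fun p hp => ?_
  refine h p (not_le.mp fun hle => hp ⟨?_, mem_univ _⟩)
  rwa [mem_closedBall_zero_iff]

/-- A continuous cut-off function equal to `1` on the ball of radius `R`. -/
noncomputable def ballCutoff (R : ℝ) (p : E n × Grass n d) : ℝ := max 0 (min 1 (R + 1 - ‖p.1‖))

lemma continuous_ballCutoff (R : ℝ) : Continuous (ballCutoff R : E n × Grass n d → ℝ) := by
  unfold ballCutoff
  fun_prop

lemma ballCutoff_nonneg (R : ℝ) (p : E n × Grass n d) : 0 ≤ ballCutoff R p := le_max_left _ _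

lemma ballCutoff_eq_one {R : ℝ} {p : E n × Grass n d} (hp : ‖p.1‖ ≤ R) : ballCutoff R p = 1 := by
  rw [ballCutoff, min_eq_left (by linarith), max_eq_right zero_le_one]

lemma ballCutoff_eq_zero {R : ℝ} {p : E n × Grass n d} (hp : R + 1 < ‖p.1‖) :
    ballCutoff R p = 0 := by
  rw [ballCutoff, max_eq_left]
  exact (min_le_right _ _).trans (by linarith)

section Limit

variable {W : ℕ → VMeasure n d} {ν : VMeasure n d} {M R : ℝ}

/-- Bumps positive exactly on the shells `R < ‖x‖ < k` have zero integral along the sequence, hence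
for the limit; countably many shells cover the outside. -/
lemma WeakStarTendsto.outside_eq_zero [IsLocallyFiniteMeasure ν] (hW : ∀ j, Confined (W j) M R)
    (h : WeakStarTendsto W ν) : ν {p | R < ‖p.1‖} = 0 := by
  set φ : ℕ → E n × Grass n d → ℝ := fun k p => max 0 (min (‖p.1‖ - R) (k - ‖p.1‖)) with hφ
  have hc : ∀ k, Continuous (φ k) := fun k => by simp only [hφ]; fun_prop
  have hs : ∀ k, HasCompactSupport (φ k) := fun k =>
    hasCompactSupport_of_eq_zero_outside k fun p hp => by
      simp only [hφ]
      rw [max_eq_left]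
      exact (min_le_right _ _).trans (by linarith)
  have h0 : ∀ k p, 0 ≤ φ k p := fun k p => le_max_left _ _
  have hν : ∀ k, φ k =ᵐ[ν] 0 := fun k => by
    rw [← integral_eq_zero_iff_of_nonneg (h0 k) ((hc k).integrable_of_hasCompactSupport (hs k))]
    refine tendsto_nhds_unique (h (φ k) (hc k) (hs k) (h0 k)) ?_
    have : ∀ j, ∫ p, φ k p ∂(W j) = 0 := fun j => by
      refine integral_eq_zero_of_ae ?_
      filter_upwards [(hW j).ae_norm_le] with p hp
      simp only [hφ, Pi.zero_apply]
      rw [max_eq_left]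
      exact (min_le_left _ _).trans (by linarith)
    simp [this]
  have hall := ae_all_iff.mpr hν
  have : ∀ᵐ p ∂ν, ¬ R < ‖p.1‖ := by
    filter_upwards [hall] with p hp hlt
    obtain ⟨k, hk⟩ := exists_nat_gt ‖p.1‖
    have h1 := hp k
    simp only [hφ, Pi.zero_apply] at h1
    have h2 : 0 < min (‖p.1‖ - R) (k - ‖p.1‖) := lt_min (by linarith) (by linarith)
    rw [max_eq_right h2.le] at h1
    linarith
  rw [ae_iff] at this
  simpa only [not_not] using this

lemma isFiniteMeasure_of_outside [IsLocallyFiniteMeasure ν] (h : ν {p | R < ‖p.1‖} = 0) :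
    IsFiniteMeasure ν := by
  have hK : IsCompact (Metric.closedBall (0 : E n) R ×ˢ (univ : Set (Grass n d))) :=
    (isCompact_closedBall (0 : E n) R).prod isCompact_univ
  refine ⟨?_⟩
  have hsub : (univ : Set (E n × Grass n d)) ⊆
      (Metric.closedBall (0 : E n) R ×ˢ univ) ∪ {p | R < ‖p.1‖} := fun p _ => by
    by_cases hp : ‖p.1‖ ≤ R
    · exact Or.inl ⟨by rwa [mem_closedBall_zero_iff], mem_univ _⟩
    · exact Or.inr (not_le.mp hp)
  calc ν univ ≤ ν (Metric.closedBall (0 : E n) R ×ˢ univ) + ν {p | R < ‖p.1‖} :=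
        (measure_mono hsub).trans (measure_union_le _ _)
    _ < ⊤ := by rw [h, add_zero]; exact hK.measure_lt_top

lemma WeakStarTendsto.confined [IsLocallyFiniteMeasure ν] (hM : 0 ≤ M)
    (hW : ∀ j, Confined (W j) M R) (h : WeakStarTendsto W ν) : Confined ν M R := by
  have hout := h.outside_eq_zero hW
  have hfin := isFiniteMeasure_of_outside hout
  refine ⟨?_, hout⟩
  have h1 : ∀ (μ : VMeasure n d), μ {p | R < ‖p.1‖} = 0 →
      ∫ p, ballCutoff R p ∂μ = μ.real univ := fun μ hμ => by
    have h2 : ∀ᵐ p ∂μ, ballCutoff R p = 1 := by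
      have h3 : ∀ᵐ p ∂μ, ¬ R < ‖p.1‖ := by rw [ae_iff]; simpa only [not_not] using hμ
      filter_upwards [h3] with p hp
      exact ballCutoff_eq_one (not_lt.mp hp)
    rw [integral_congr_ae h2]
    simp
  have h4 := h (ballCutoff R) (continuous_ballCutoff R)
    (hasCompactSupport_of_eq_zero_outside (R + 1) fun p => ballCutoff_eq_zero) (ballCutoff_nonneg R)
  rw [h1 ν hout] at h4
  have h5 : ν.real univ ≤ M := le_of_tendsto' h4 fun j => by
    rw [h1 _ (hW j).outside]
    exact (hW j).real_le hM
  rw [← ENNReal.ofReal_toReal (measure_ne_top ν univ)]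
  exact ENNReal.ofReal_le_ofReal h5

/-- The cut-off does not change integrals against measures carried by the ball, so compact support
of `φ` is not needed; splitting into positive and negative parts meets the sign condition on test
functions. -/
lemma WeakStarTendsto.tendsto_integral [IsLocallyFiniteMeasure ν]
    (hW : ∀ j, Confined (W j) M R) (h : WeakStarTendsto W ν) {φ : E n × Grass n d → ℝ}
    (hφ : Continuous φ) :
    Tendsto (fun j => ∫ p, φ p ∂(W j)) atTop (𝓝 (∫ p, φ p ∂ν)) := by
  have hout := h.outside_eq_zero hW
  have hfin := isFiniteMeasure_of_outside hout
  set f : E n × Grass n d → ℝ := fun p => max (φ p * ballCutoff R p) 0 with hf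
  set g : E n × Grass n d → ℝ := fun p => max (-(φ p * ballCutoff R p)) 0 with hg
  have hχ := continuous_ballCutoff (n := n) (d := d) R
  have hfc : Continuous f := (hφ.mul hχ).max continuous_const
  have hgc : Continuous g := (hφ.mul hχ).neg.max continuous_const
  have hfs : HasCompactSupport f := hasCompactSupport_of_eq_zero_outside (R + 1) fun p hp => by
    simp [hf, ballCutoff_eq_zero hp]
  have hgs : HasCompactSupport g := hasCompactSupport_of_eq_zero_outside (R + 1) fun p hp => by
    simp [hg, ballCutoff_eq_zero hp]
  have key : ∀ μ : VMeasure n d, IsFiniteMeasure μ → μ {p | R < ‖p.1‖} = 0 →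
      ∫ p, φ p ∂μ = ∫ p, f p ∂μ - ∫ p, g p ∂μ := fun μ _ hμ => by
    rw [← integral_sub (hfc.integrable_of_hasCompactSupport hfs)
      (hgc.integrable_of_hasCompactSupport hgs)]
    have h3 : ∀ᵐ p ∂μ, ¬ R < ‖p.1‖ := by rw [ae_iff]; simpa only [not_not] using hμ
    refine integral_congr_ae ?_
    filter_upwards [h3] with p hp
    simp only [hf, hg, ballCutoff_eq_one (not_lt.mp hp), mul_one]
    exact (max_zero_sub_eq_self (φ p)).symm
  rw [key ν hfin hout]
  simp_rw [fun j => key (W j) (hW j).isFiniteMeasure (hW j).outside]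
  exact (h f hfc hfs fun p => le_max_right _ _).sub (h g hgc hgs fun p => le_max_right _ _)

lemma WeakStarTendsto.tendsto_real_univ [IsLocallyFiniteMeasure ν]
    (hW : ∀ j, Confined (W j) M R) (h : WeakStarTendsto W ν) :
    Tendsto (fun j => (W j).real univ) atTop (𝓝 (ν.real univ)) := by
  simpa using h.tendsto_integral hW (continuous_const (y := (1 : ℝ)))

lemma WeakStarTendsto.tendsto_convMass (hψ : IsCutoff ψ) [IsLocallyFiniteMeasure ν]
    (hW : ∀ j, Confined (W j) M R) (h : WeakStarTendsto W ν) (x : E n) :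
    Tendsto (fun j => convMass ψ ε (W j) x) atTop (𝓝 (convMass ψ ε ν x)) := by
  simp_rw [convMass_eq hψ]
  exact h.tendsto_integral hW
    ((contDiff_kernel hψ).continuous.comp (continuous_fst.sub continuous_const))

/-- Reduces the vector-valued integral to scalar ones, the only kind that weak convergence tests. -/
lemma convFirstVar_eq_sum (hψ : IsCutoff ψ) (V : VMeasure n d) [IsFiniteMeasure V] (x : E n) :
    convFirstVar ψ ε V x = ∑ i, (∫ p, inner ℝ (EuclideanSpace.basisFun (Fin n) ℝ i)
      (p.2.1 (gradient (kernel ψ ε) (p.1 - x))) ∂V) • EuclideanSpace.basisFun (Fin n) ℝ i := by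
  have hi : Integrable (fun p : E n × Grass n d =>
      p.2.1 (gradient (kernel ψ ε) (p.1 - x))) V := by
    refine Integrable.of_bound ((continuous_plane_gradient hψ).comp
      (continuous_id.prodMk continuous_const)).aestronglyMeasurable (slopeBound ψ ε) ?_
    exact ae_of_all _ fun p => norm_plane_gradient_le hψ p x
  conv_lhs => rw [← (EuclideanSpace.basisFun (Fin n) ℝ).sum_repr' (convFirstVar ψ ε V x)]
  refine Finset.sum_congr rfl fun i _ => ?_
  congr 1
  exact (integral_inner (𝕜 := ℝ) hi _).symm

lemma WeakStarTendsto.tendsto_convFirstVar (hψ : IsCutoff ψ) [IsLocallyFiniteMeasure ν]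
    (hW : ∀ j, Confined (W j) M R) (h : WeakStarTendsto W ν) (x : E n) :
    Tendsto (fun j => convFirstVar ψ ε (W j) x) atTop (𝓝 (convFirstVar ψ ε ν x)) := by
  have := isFiniteMeasure_of_outside (h.outside_eq_zero hW)
  have := fun j => (hW j).isFiniteMeasure
  simp_rw [convFirstVar_eq_sum hψ]
  refine tendsto_finsetSum _ fun i _ => Tendsto.smul_const (h.tendsto_integral hW ?_) _
  exact continuous_const.inner ((continuous_plane_gradient hψ).comp
    (continuous_id.prodMk continuous_const))

lemma WeakStarTendsto.tendsto_dissipation (hψ : IsCutoff ψ) (hε : 0 < ε)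
    [IsLocallyFiniteMeasure ν] (hM : 0 ≤ M)
    (hW : ∀ j, Confined (W j) M R) (h : WeakStarTendsto W ν) :
    Tendsto (fun j => dissipation ψ ε (W j)) atTop (𝓝 (dissipation ψ ε ν)) := by
  refine tendsto_integral_of_dominated_convergence _
    (fun j => (integrable_dissipationDensity hψ hε hM (hW j)).aestronglyMeasurable)
    (integrable_indicator_closedBall (R + 1) ((slopeBound ψ ε * M) ^ 2 / ε))
    (fun j => ae_of_all _ fun y => ?_) (ae_of_all _ fun y => ?_)
  · rw [Real.norm_of_nonneg (dissipationDensity_nonneg hψ hε _ y)]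
    exact dissipationDensity_le hψ hε hM (hW j) y
  · refine ((h.tendsto_convFirstVar hψ hW y).norm.pow 2).div
      ((h.tendsto_convMass hψ hW y).add_const ε) ?_
    exact (add_pos_of_nonneg_of_pos (convMass_nonneg hψ ν y) hε).ne'

end Limit

end ApproxMCF

namespace ApproxMCF
variable {n d : ℕ} {ψ : E n → ℝ} {ε : ℝ}

/-! ### Subdivisions -/

namespace Subdivision

variable (T : Subdivision)

lemma monotoneOn : ∀ j ≤ T.m, ∀ i ≤ j, T.t i ≤ T.t j := by
  intro j
  induction j with
  | zero => intro _ i hi; rw [Nat.le_zero.mp hi]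
  | succ j ih =>
    intro hj i hi
    rcases Nat.le_succ_iff.mp hi with h | h
    · exact (ih (by lia) i h).trans (T.lt_succ j (by lia)).le
    · rw [h]

lemma t_nonneg {i : ℕ} (hi : i ≤ T.m) : 0 ≤ T.t i := by
  rw [← T.start]; exact T.monotoneOn i hi 0 (Nat.zero_le i)

lemma t_le_one {i : ℕ} (hi : i ≤ T.m) : T.t i ≤ 1 := by
  rw [← T.finish]; exact T.monotoneOn T.m le_rfl i hi

lemma m_pos : 0 < T.m := by
  rcases Nat.eq_zero_or_pos T.m with h | h
  · have h1 := T.finish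
    rw [h, T.start] at h1
    exact absurd h1 zero_ne_one
  · exact h

lemma sub_le_size {i : ℕ} (hi : i < T.m) : T.t (i + 1) - T.t i ≤ T.size :=
  le_ciSup (f := fun i : Fin T.m => T.t (i + 1) - T.t i) (Set.finite_range _).bddAbove ⟨i, hi⟩

lemma index_lt (s : ℝ) : T.index s < T.m :=
  lt_of_le_of_lt (Nat.findGreatest_le _) (Nat.sub_lt T.m_pos one_pos)

lemma t_index_le {s : ℝ} (hs : 0 ≤ s) : T.t (T.index s) ≤ s := by
  classical
  exact Nat.findGreatest_spec (P := fun i => T.t i ≤ s) (Nat.zero_le (T.m - 1))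
    (by rw [T.start]; exact hs)

lemma le_t_index_succ {s : ℝ} (hs : s ≤ 1) : s ≤ T.t (T.index s + 1) := by
  classical
  by_cases h : T.index s + 1 ≤ T.m - 1
  · exact (not_le.mp (Nat.findGreatest_is_greatest (P := fun i => T.t i ≤ s)
      (Nat.lt_succ_self _) h)).le
  -- The search stops at `m - 1`, so the last interval is closed on the right and contains `s = 1`.
  · have h1 := T.index_lt s
    have h2 : T.index s + 1 = T.m := by lia
    rw [h2, T.finish]
    exact hs

lemma index_eq {i : ℕ} (hi : i < T.m) {u : ℝ} (h1 : T.t i ≤ u) (h2 : u < T.t (i + 1)) :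
    T.index u = i := by
  classical
  unfold index
  rw [Nat.findGreatest_eq_iff]
  refine ⟨by lia, fun _ => h1, fun j hj hjm hle => ?_⟩
  have := T.monotoneOn j (by lia) (i + 1) hj
  linarith

lemma sub_t_index_le_size {s : ℝ} (hs : s ≤ 1) : s - T.t (T.index s) ≤ T.size :=
  (sub_le_sub_right (T.le_t_index_succ hs) _).trans (T.sub_le_size (T.index_lt s))

lemma measurable_index : Measurable T.index := by
  classical
  exact measurable_findGreatest fun _ _ => measurableSet_le measurable_const measurable_id

end Subdivision

/-! ### The time-discrete flow -/

/-- The mass expansion with error `1 · τ`, its dissipation term dropped. The threshold depends on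
the ceiling `M` and not on the current mass `M'`, so the step can be iterated. -/
lemma exists_step_confined (hψ : IsCutoff ψ) (hε : 0 < ε) (d : ℕ) {M : ℝ} (hM : 0 ≤ M) :
    ∃ C > 0, ∃ τ₀ > 0, ∀ (τ : ℝ) (V : VMeasure n d) (M' R : ℝ), 0 ≤ τ → τ ≤ τ₀ → 0 ≤ M' →
      M' ≤ M → Confined V M' R → Confined (step ψ ε τ V) (M' + τ) (R + τ * C) := by
  obtain ⟨C, hC0, hC⟩ := exists_curvature_bound (n := n) hψ hε d hM
  obtain ⟨τ₁, hτ₁, hmass⟩ := exists_mass_step_expansion (n := n) hψ hε d hM one_pos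
  refine ⟨C, hC0, min τ₁ (1 / 2 / C), by positivity, fun τ V M' R hτ0 hτ hM' hMM hV => ?_⟩
  have hV' := hV.mono hMM le_rfl
  obtain ⟨hH, hD⟩ := hC V R hV'
  obtain ⟨hfin, hm⟩ := hmass τ V R hτ0 (hτ.trans (min_le_left _ _)) hV'
  refine ⟨?_, step_outside hψ hε hV hD hH hτ0
    ((le_div_iff₀ hC0).mp (hτ.trans (min_le_right _ _)))⟩
  rw [← ENNReal.ofReal_toReal (measure_ne_top (step ψ ε τ V) univ)]
  refine ENNReal.ofReal_le_ofReal ?_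
  have h1 := (abs_le.mp hm).2
  have h2 := hV.real_le hM'
  have h3 := mul_nonneg hτ0 (dissipation_nonneg hψ hε V)
  change (step ψ ε τ V).real univ ≤ _
  linarith

/-- The mass grows at rate at most 1 and the radius at rate at most `C`. The total time is 1, so the
ceiling `M + 1` is never exceeded and the induction closes. -/
lemma exists_nodeFlow_confined (hψ : IsCutoff ψ) (hε : 0 < ε) {V₀ : VMeasure n d} {M R : ℝ}
    (hM : 0 ≤ M) (hV : Confined V₀ M R) :
    ∃ R', ∃ τ₀ > 0, ∀ T : Subdivision, T.size ≤ τ₀ → ∀ i ≤ T.m,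
      Confined (nodeFlow ψ ε T V₀ i) (M + 1) R' := by
  obtain ⟨C, hC0, τ₀, hτ₀, h⟩ := exists_step_confined (n := n) hψ hε d (M := M + 1) (by linarith)
  refine ⟨R + C, τ₀, hτ₀, fun T hT => ?_⟩
  have key : ∀ i ≤ T.m, Confined (nodeFlow ψ ε T V₀ i) (M + T.t i) (R + T.t i * C) := by
    intro i
    induction i with
    | zero => intro _; simpa [nodeFlow, T.start] using hV
    | succ i ih =>
      intro hi
      have hi' : i < T.m := hi
      have h1 := T.t_nonneg hi'.le
      have h2 := T.t_le_one hi'.le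
      have h3 := h (T.t (i + 1) - T.t i) _ _ _ (sub_nonneg.mpr (T.lt_succ i hi').le)
        ((T.sub_le_size hi').trans hT) (by linarith) (by linarith) (ih hi'.le)
      have e1 : M + T.t i + (T.t (i + 1) - T.t i) = M + T.t (i + 1) := by ring
      have e2 : R + T.t i * C + (T.t (i + 1) - T.t i) * C = R + T.t (i + 1) * C := by ring
      rwa [e1, e2] at h3
  intro i hi
  have h2 := T.t_le_one hi
  exact (key i hi).mono (by linarith) (by nlinarith)

section MassBalance

variable {T : Subdivision} {V₀ : VMeasure n d} {M R : ℝ}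

/-- The piecewise constant interpolation of the time-discrete flow. -/
noncomputable def constFlow (ψ : E n → ℝ) (ε : ℝ) (T : Subdivision) (V₀ : VMeasure n d) (s : ℝ) :
    VMeasure n d := nodeFlow ψ ε T V₀ (T.index s)

/-- Time enters only through the natural number `T.index s`, so no measurability in the varifold is
needed. -/
lemma measurable_dissipation_constFlow (T : Subdivision) (V₀ : VMeasure n d) :
    Measurable fun s => dissipation ψ ε (constFlow ψ ε T V₀ s) :=
  (measurable_from_nat (f := fun i => dissipation ψ ε (nodeFlow ψ ε T V₀ i))).comp
    T.measurable_index

lemma confined_constFlow (h : ∀ i ≤ T.m, Confined (nodeFlow ψ ε T V₀ i) M R) (s : ℝ) :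
    Confined (constFlow ψ ε T V₀ s) M R := h _ (T.index_lt s).le

lemma intervalIntegrable_dissipation_constFlow (hψ : IsCutoff ψ) (hε : 0 < ε) {D : ℝ}
    (h : ∀ s, dissipation ψ ε (constFlow ψ ε T V₀ s) ≤ D) (a b : ℝ) :
    IntervalIntegrable (fun s => dissipation ψ ε (constFlow ψ ε T V₀ s)) volume a b := by
  refine (intervalIntegrable_const (c := D)).mono_fun
    (measurable_dissipation_constFlow T V₀).aestronglyMeasurable (ae_of_all _ fun s => ?_)
  simp only
  rw [Real.norm_of_nonneg (dissipation_nonneg hψ hε _)]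
  exact (h s).trans (le_abs_self D)

lemma integral_dissipation_constFlow {i : ℕ} (hi : i < T.m) :
    ∫ s in T.t i..T.t (i + 1), dissipation ψ ε (constFlow ψ ε T V₀ s)
      = (T.t (i + 1) - T.t i) * dissipation ψ ε (nodeFlow ψ ε T V₀ i) := by
  have h : EqOn (fun s => dissipation ψ ε (constFlow ψ ε T V₀ s))
      (fun _ => dissipation ψ ε (nodeFlow ψ ε T V₀ i)) (Ioo (T.t i) (T.t (i + 1))) := fun u hu => by
    simp only [constFlow, T.index_eq hi hu.1.le hu.2]
  rw [intervalIntegral.integral_congr_Ioo_of_le (T.lt_succ i hi).le h,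
    intervalIntegral.integral_const, smul_eq_mul]

/-- The approximate mass balance of the time-discrete flow. -/
lemma exists_nodeFlow_mass_balance (hψ : IsCutoff ψ) (hε : 0 < ε) (V₀ : VMeasure n d)
    (hM : 0 ≤ M) (R : ℝ) {η : ℝ} (hη : 0 < η) :
    ∃ τ₀ > 0, ∀ T : Subdivision, T.size ≤ τ₀ →
      (∀ i ≤ T.m, Confined (nodeFlow ψ ε T V₀ i) M R) → ∀ i ≤ T.m,
      |(nodeFlow ψ ε T V₀ i).real univ - V₀.real univ
        + ∫ s in (0 : ℝ)..T.t i, dissipation ψ ε (constFlow ψ ε T V₀ s)| ≤ η * T.t i := by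
  obtain ⟨τ₀, hτ₀, h⟩ := exists_mass_step_expansion (n := n) hψ hε d hM hη
  obtain ⟨D, hD⟩ := exists_dissipation_bound (n := n) hψ hε d hM R
  refine ⟨τ₀, hτ₀, fun T hT hconf i => ?_⟩
  have hint := intervalIntegrable_dissipation_constFlow hψ hε
    (fun s => hD _ (confined_constFlow hconf s))
  induction i with
  | zero => intro _; simp [nodeFlow, T.start]
  | succ i ih =>
    intro hi
    have hi' : i < T.m := hi
    have h1 := ih hi'.le
    obtain ⟨-, h2⟩ := h (T.t (i + 1) - T.t i) _ R (sub_nonneg.mpr (T.lt_succ i hi').le)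
      ((T.sub_le_size hi').trans hT) (hconf i hi'.le)
    -- The integral over the new interval is exactly the one-step dissipation term, so the errors `η
    -- (t (i+1) - t i)` telescope.
    rw [← intervalIntegral.integral_add_adjacent_intervals (hint 0 (T.t i)) (hint _ _),
      integral_dissipation_constFlow hi']
    change |(step ψ ε (T.t (i + 1) - T.t i) (nodeFlow ψ ε T V₀ i)).real univ - _ + _| ≤ _
    rw [abs_le] at h1 h2 ⊢
    constructor <;> linarith [h1.1, h1.2, h2.1, h2.2]

end MassBalance

/-! ### The limit flow -/

section LimitFlow

variable {T : ℕ → Subdivision} {V₀ : VMeasure n d} {V : ℝ → VMeasure n d} {M R : ℝ}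

/-- At each time the two flows differ by a single step no longer than the mesh, which barely changes
the integral of a fixed test function. -/
lemma weakStarTendsto_constFlow (hψ : IsCutoff ψ) (hε : 0 < ε) (hM : 0 ≤ M)
    (hT : Tendsto (fun j => (T j).size) atTop (𝓝 0))
    (hconf : ∀ j, ∀ i ≤ (T j).m, Confined (nodeFlow ψ ε (T j) V₀ i) M R) {s : ℝ}
    (hs : s ∈ Icc (0 : ℝ) 1) {ν : VMeasure n d}
    (h : WeakStarTendsto (fun j => discreteFlow ψ ε (T j) V₀ s) ν) :
    WeakStarTendsto (fun j => constFlow ψ ε (T j) V₀ s) ν := by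
  intro φ hφ hφc hφ0
  refine (h φ hφ hφc hφ0).congr_dist ?_
  rw [Metric.tendsto_atTop]
  intro η hη
  obtain ⟨τ₀, hτ₀, hstep⟩ := exists_test_step_bound hψ hε hM hφ hφc (half_pos hη)
  obtain ⟨N, hN⟩ := (Metric.tendsto_atTop.mp hT) τ₀ hτ₀
  refine ⟨N, fun j hj => ?_⟩
  have h1 : (T j).size ≤ τ₀ := by
    have := hN j hj
    rw [Real.dist_eq, sub_zero] at this
    exact (le_abs_self _).trans this.le
  have h2 := hstep (s - (T j).t ((T j).index s)) (constFlow ψ ε (T j) V₀ s) R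
    (sub_nonneg.mpr ((T j).t_index_le hs.1)) (((T j).sub_t_index_le_size hs.2).trans h1)
    (confined_constFlow (hconf j) s)
  rw [Real.dist_eq, sub_zero, abs_of_nonneg dist_nonneg, Real.dist_eq]
  exact lt_of_le_of_lt h2 (half_lt_self hη)

/-- The mass balance of the limit flow. -/
lemma limit_mass_balance (hψ : IsCutoff ψ) (hε : 0 < ε) (hM : 0 ≤ M)
    (hT : Tendsto (fun j => (T j).size) atTop (𝓝 0))
    (hconf : ∀ j, ∀ i ≤ (T j).m, Confined (nodeFlow ψ ε (T j) V₀ i) M R)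
    (hloc : ∀ t ∈ Icc (0 : ℝ) 1, IsLocallyFiniteMeasure (V t))
    (h : ∀ t ∈ Icc (0 : ℝ) 1, WeakStarTendsto (fun j => discreteFlow ψ ε (T j) V₀ t) (V t)) :
    (∀ t ∈ Icc (0 : ℝ) 1, Confined (V t) M R) ∧
    IntegrableOn (fun t => dissipation ψ ε (V t)) (Icc 0 1) ∧
    ∀ s ∈ Icc (0 : ℝ) 1,
      (V s).real univ = V₀.real univ - ∫ t in (0 : ℝ)..s, dissipation ψ ε (V t) := by
  have hW : ∀ t ∈ Icc (0 : ℝ) 1, WeakStarTendsto (fun j => constFlow ψ ε (T j) V₀ t) (V t) :=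
    fun t ht => weakStarTendsto_constFlow hψ hε hM hT hconf ht (h t ht)
  have hWc : ∀ t j, Confined (constFlow ψ ε (T j) V₀ t) M R :=
    fun t j => confined_constFlow (hconf j) t
  have hVc : ∀ t ∈ Icc (0 : ℝ) 1, Confined (V t) M R := fun t ht =>
    have := hloc t ht
    (hW t ht).confined hM (hWc t)
  have hDt : ∀ t ∈ Icc (0 : ℝ) 1, Tendsto (fun j => dissipation ψ ε (constFlow ψ ε (T j) V₀ t))
      atTop (𝓝 (dissipation ψ ε (V t))) := fun t ht =>
    have := hloc t ht
    (hW t ht).tendsto_dissipation hψ hε hM (hWc t)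
  obtain ⟨D, hD⟩ := exists_dissipation_bound (n := n) hψ hε d hM R
  have hD0 : 0 ≤ D := (dissipation_nonneg hψ hε _).trans (hD _ (hWc 0 0))
  refine ⟨hVc, ?_, fun s hs => ?_⟩
  · refine Integrable.mono' (g := fun _ => D) (integrable_const D) ?_ ?_
    -- No regularity of `t ↦ V t` is assumed: measurability comes from the pointwise limit of step
    -- functions.
    · exact aestronglyMeasurable_of_tendsto_ae atTop
        (fun j => (measurable_dissipation_constFlow (T j) V₀).aestronglyMeasurable)
        ((ae_restrict_iff' measurableSet_Icc).mpr (ae_of_all _ hDt))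
    · refine (ae_restrict_iff' measurableSet_Icc).mpr (ae_of_all _ fun t ht => ?_)
      rw [Real.norm_of_nonneg (dissipation_nonneg hψ hε _)]
      exact hD _ (hVc t ht)
  have hlim1 : Tendsto (fun j => ∫ t in (0 : ℝ)..s, dissipation ψ ε (constFlow ψ ε (T j) V₀ t))
      atTop (𝓝 (∫ t in (0 : ℝ)..s, dissipation ψ ε (V t))) := by
    refine intervalIntegral.tendsto_integral_filter_of_dominated_convergence (fun _ => D)
      (Eventually.of_forall fun j =>
        (measurable_dissipation_constFlow (T j) V₀).aestronglyMeasurable)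
      (Eventually.of_forall fun j => ae_of_all _ fun t _ => ?_) intervalIntegrable_const
      (ae_of_all _ fun t ht => ?_)
    · rw [Real.norm_of_nonneg (dissipation_nonneg hψ hε _)]
      exact hD _ (hWc t j)
    · rw [uIoc_of_le hs.1] at ht
      exact hDt t ⟨ht.1.le, ht.2.trans hs.2⟩
  have hlim2 : Tendsto (fun j => (constFlow ψ ε (T j) V₀ s).real univ) atTop
      (𝓝 ((V s).real univ)) :=
    have := hloc s hs
    (hW s hs).tendsto_real_univ (hWc s)
  have hlim3 : Tendsto (fun j => (constFlow ψ ε (T j) V₀ s).real univ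
      + ∫ t in (0 : ℝ)..s, dissipation ψ ε (constFlow ψ ε (T j) V₀ t)) atTop
      (𝓝 (V₀.real univ)) := by
    rw [Metric.tendsto_atTop]
    intro η hη
    -- One `η / 4` pays for the balance up to the last node before `s`, another for the dissipation
    -- between that node and `s`, at most `D` times the mesh.
    obtain ⟨τ₀, hτ₀, hbal⟩ := exists_nodeFlow_mass_balance hψ hε V₀ hM R (η := η / 4) (by positivity)
    have hτ' : 0 < min τ₀ (η / 4 / (D + 1)) := by positivity
    obtain ⟨N, hN⟩ := (Metric.tendsto_atTop.mp hT) _ hτ'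
    refine ⟨N, fun j hj => ?_⟩
    have h1 : (T j).size ≤ min τ₀ (η / 4 / (D + 1)) := by
      have := hN j hj
      rw [Real.dist_eq, sub_zero] at this
      exact (le_abs_self _).trans this.le
    have h2 := hbal (T j) (h1.trans (min_le_left _ _)) (hconf j) _ ((T j).index_lt s).le
    have h3 : (T j).size * (D + 1) ≤ η / 4 :=
      (le_div_iff₀ (by positivity)).mp (h1.trans (min_le_right _ _))
    have hint := intervalIntegrable_dissipation_constFlow hψ hε (fun u => hD _ (hWc u j))
    have h4 := (T j).t_index_le hs.1
    have h5 := (T j).sub_t_index_le_size hs.2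
    have h6 : |∫ t in ((T j).t ((T j).index s))..s, dissipation ψ ε (constFlow ψ ε (T j) V₀ t)|
        ≤ D * |s - (T j).t ((T j).index s)| := by
      rw [← Real.norm_eq_abs]
      refine intervalIntegral.norm_integral_le_of_norm_le_const fun t _ => ?_
      rw [Real.norm_of_nonneg (dissipation_nonneg hψ hε _)]
      exact hD _ (hWc t j)
    rw [abs_of_nonneg (sub_nonneg.mpr h4)] at h6
    have h7 := (T j).t_le_one ((T j).index_lt s).le
    rw [Real.dist_eq, ← intervalIntegral.integral_add_adjacent_intervals
      (hint 0 ((T j).t ((T j).index s))) (hint _ _)]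
    change |(constFlow ψ ε (T j) V₀ s).real univ - _ + _| ≤ _ at h2
    rw [abs_le] at h2 h6
    rw [abs_lt]
    constructor <;> nlinarith [h2.1, h2.2, h6.1, h6.2]
  have := tendsto_nhds_unique hlim3 (hlim2.add hlim1)
  linarith

end LimitFlow

/-! ### Confinement of the initial varifold and conclusion. -/

lemma exists_confined (V₀ : VMeasure n d) [IsFiniteMeasure V₀] (hsupp : IsCompact V₀.support) :
    ∃ R, Confined V₀ (V₀.real univ) R := by
  obtain ⟨R, hR⟩ := (hsupp.image continuous_fst).isBounded.exists_norm_le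
  refine ⟨R, (ENNReal.ofReal_toReal (measure_ne_top V₀ univ)).ge, ?_⟩
  have hsub : {p : E n × Grass n d | R < ‖p.1‖} ⊆ V₀.supportᶜ := fun p hp hps =>
    absurd (hR p.1 ⟨p, hps, rfl⟩) (not_le.mpr hp)
  exact measure_mono_null hsub Measure.measure_compl_support

end ApproxMCF

open ApproxMCF

theorem mainTheorem5 {n d : ℕ} (hd : 1 ≤ d) (hdn : d ≤ n) (hn : 2 ≤ n)
    (ψ : E n → ℝ) (hψ : IsCutoff ψ) (ε : ℝ) (hε : ε ∈ Ioo (0 : ℝ) 1)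
    (V₀ : VMeasure n d) (hfin : mass V₀ univ < ⊤) (hsupp : IsCompact V₀.support)
    (V : ℝ → VMeasure n d) (hV : IsApproxFlow ψ ε V₀ V) :
    -- well-definedness of the masses and of the space and time integrals
    (∀ t ∈ Icc (0 : ℝ) 1, mass (V t) univ < ⊤ ∧
      Integrable (fun y => dissipationDensity ψ ε (V t) y)) ∧
    IntegrableOn (fun t => ∫ y, dissipationDensity ψ ε (V t) y) (Icc 0 1) ∧
    -- the mass balance and the monotonicity of the mass
    (∀ a b : ℝ, 0 ≤ a → a < b → b ≤ 1 →
      (mass (V b)).real univ - (mass (V a)).real univ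
          = -∫ t in a..b, ∫ y, dissipationDensity ψ ε (V t) y ∧
      (mass (V b)).real univ - (mass (V a)).real univ ≤ 0) ∧
    -- the bounds on the mass and on the total dissipation
    (∀ t ∈ Icc (0 : ℝ) 1, (mass (V t)).real univ ≤ (mass V₀).real univ) ∧
    ∫ t in (0 : ℝ)..1, ∫ y, dissipationDensity ψ ε (V t) y ≤ (mass V₀).real univ := by
  have hε0 : 0 < ε := hε.1
  have : IsFiniteMeasure V₀ := ⟨by rwa [mass_univ] at hfin⟩
  have hM : 0 ≤ V₀.real univ := measureReal_nonneg
  obtain ⟨R, hR⟩ := exists_confined V₀ hsupp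
  obtain ⟨R', τ₀, hτ₀, hnode⟩ := exists_nodeFlow_confined hψ hε0 hM hR
  obtain ⟨hloc, T, hT, hflow⟩ := hV
  obtain ⟨N, hN⟩ := (Metric.tendsto_atTop.mp hT) τ₀ hτ₀
  -- Dropping the first `N` subdivisions leaves the limits unchanged and makes the confinement
  -- bounds hold for every index.
  have hshift := tendsto_add_atTop_nat N
  have hsize : ∀ j, (T (j + N)).size ≤ τ₀ := fun j => by
    have := hN (j + N) (Nat.le_add_left N j)
    rw [Real.dist_eq, sub_zero] at this
    exact (le_abs_self _).trans this.le
  obtain ⟨hconf, hint, hbal⟩ := limit_mass_balance (T := fun j => T (j + N)) (V₀ := V₀) (V := V)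
    (M := V₀.real univ + 1) (R := R') hψ hε0 (by linarith) (hT.comp hshift)
    (fun j => hnode _ (hsize j)) hloc
    (fun t ht φ h1 h2 h3 => (hflow t ht φ h1 h2 h3).comp hshift)
  simp_rw [mass_real_univ]
  have hII : ∀ a b : ℝ, 0 ≤ a → a ≤ b → b ≤ 1 →
      IntervalIntegrable (fun t => dissipation ψ ε (V t)) volume a b := fun a b ha hab hb =>
    (intervalIntegrable_iff_integrableOn_Icc_of_le hab).mpr (hint.mono_set (Icc_subset_Icc ha hb))
  have hpos : ∀ a b : ℝ, a ≤ b → 0 ≤ ∫ t in a..b, dissipation ψ ε (V t) := fun a b hab =>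
    intervalIntegral.integral_nonneg hab fun t _ => dissipation_nonneg hψ hε0 (V t)
  have hdiff : ∀ a b : ℝ, 0 ≤ a → a < b → b ≤ 1 →
      (V b).real univ - (V a).real univ = -∫ t in a..b, dissipation ψ ε (V t) := by
    intro a b ha hab hb
    rw [hbal b ⟨ha.trans hab.le, hb⟩, hbal a ⟨ha, hab.le.trans hb⟩,
      ← intervalIntegral.integral_add_adjacent_intervals (hII 0 a le_rfl ha (hab.le.trans hb))
        (hII a b ha hab.le hb)]
    ring
  refine ⟨fun t ht => ⟨?_, integrable_dissipationDensity hψ hε0 (by linarith) (hconf t ht)⟩,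
    hint, fun a b ha hab hb => ⟨hdiff a b ha hab hb, ?_⟩, fun t ht => ?_, ?_⟩
  · rw [mass_univ]
    exact (hconf t ht).le_mass.trans_lt ENNReal.ofReal_lt_top
  · rw [hdiff a b ha hab hb]
    exact neg_nonpos.mpr (hpos a b hab.le)
  · rw [hbal t ht]
    linarith [hpos 0 t ht.1]
  · have h1 := hbal 1 (right_mem_Icc.mpr zero_le_one)
    have h2 : 0 ≤ (V 1).real univ := measureReal_nonneg
    change ∫ t in (0 : ℝ)..1, dissipation ψ ε (V t) ≤ _
    linarith
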